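/- Let $d\ge 1$ and write $[d]=\{1,\dots,d\}$. For each $n\in\mathbb N$ let $q_1(n),\dots,q_d(n)$ be nonnegative integers with $q_1(n)+\cdots+q_d(n)=n$, such that for every $k\in[d]$, as $n\to\infty$, $q_k(n)\to\infty$ and $q_k(n)/n\to\rho_k$ (so $\rho_k\ge 0$), and such that at most one of $\rho_1,\dots,\rho_d$ is zero. Write $n\times n$ complex matrices as $d\times d$ block matrices whose $(k,l)$-th block has size $q_k(n)\times q_l(n)$. For a $q_k(n)\times q_l(n)$ matrix $M$ let $\widetilde M$ be the $n\times n$ matrix whose $(k,l)$-th block is $M$ and whose other blocks are zero. Put $p_k(n)=\widetilde{I_{q_k(n)}}$. A matrix is called *almost diagonal of type $(u,v)$* if it equals $\widetilde M$ for some (rectangular) diagonal $q_u(n)\times q_v(n)$ matrix $M$. For an $n\times n$ matrix $X$ with diagonal blocks $X_{kk}$ let $$\operatorname{E}(X)=\Big(\tfrac1{q_1(n)}\operatorname{Tr}X_{11},\dots,\tfrac1{q_d(n)}\operatorname{Tr}X_{dd}\Big)\in\mathbb C^d ,$$ with the sup norm on $\mathbb C^d$ (a coordinate is $0$ if $q_k(n)=0$,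 which happens for finitely many $n$ only). On matrices $\|\cdot\|$ is the operator norm. Let $\mathbb U_k(n)$ be the compact group of matrices $\widetilde U$ with $U$ a unitary $q_k(n)\times q_k(n)$ matrix; its unit is $p_k(n)$, and powers of its elements are taken in this group. For each $n$ let $(V(s,k,n))_{s\in\mathbb N,k\in[d]}$ be an independent family of random matrices, $V(s,k,n)$ being distributed according to the Haar probability measure of $\mathbb U_k(n)$. Fix an integer $N\ge1$ and $R>0$. For a sequence $D=(D(n))_n$ of deterministic $n\times n$ matrices consider the conditions: (i) there is $u\in[d]$ such that $D(n)=p_u(n)$ for all $n$; (ii) there are $u,v\in[d]$ such that $D(n)$ is almost diagonal of type $(u,v)$ for all $n$, and $\operatorname{E}(D(n))\to0$ as $n\to\infty$. Let $(s_1,k_1),\dots,(s_N,k_N)\in\mathbb N\times[d]$, $m_1,\dots,m_N\in\mathbb Z\setminus\{0\}$ and $\eta>0$. **Case 1.** Let $D(1,n),\dots,D(N,n)$ be deterministic $n\times n$ matrices of norm at most $R$ for all $n$, such that for each $r\in\{1,\dots,N\}$ the sequence $(D(r,n))_n$ satisfies (i) or (ii), and $(s_r,k_r)\ne(s_{r+1},k_{r+1})$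 whenever it satisfies (i), where the index $N+1$ means $1$. Then $$\mathbb P\Big(\big\|\operatorname{E}\big(V(s_1,k_1,n)^{m_1}D(1,n)\cdots V(s_N,k_N,n)^{m_N}D(N,n)\big)\big\|\le\eta\Big)\xrightarrow[n\to\infty]{}1 .$$ **Case 2.** Let $D(0,n),\dots,D(N,n)$ be deterministic $n\times n$ matrices of norm at most $R$ for all $n$, such that for some $v,u\in[d]$ and all $n$, $D(0,n)$ is almost diagonal of type $(1,v)$ and $D(N,n)$ is almost diagonal of type $(u,1)$, and such that for each $r\in\{1,\dots,N-1\}$ the sequence $(D(r,n))_n$ satisfies (i) or (ii), and $(s_r,k_r)\ne(s_{r+1},k_{r+1})$ whenever it satisfies (i). Then $$\mathbb P\Big(\big\|\operatorname{E}\big(D(0,n)V(s_1,k_1,n)^{m_1}D(1,n)\cdots V(s_N,k_N,n)^{m_N}D(N,n)\big)\big\|\le\eta\Big)\xrightarrow[n\to\infty]{}1 .$$ -/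

import Mathlib

open Filter Topology MeasureTheory ProbabilityTheory

/-- The index set of a square matrix cut into blocks of sizes `q 0, …, q (d - 1)`:
the pair `⟨k, i⟩` is the `i`-th index of the `k`-th block.  It has `∑ k, q k` elements. -/
abbrev BlockIndex {d : ℕ} (q : Fin d → ℕ) : Type := (k : Fin d) × Fin (q k)

/-- Square complex matrices cut into `d²` blocks, the `(k, l)`-th block being of size `q k × q l`. -/
abbrev BlockMatrix {d : ℕ} (q : Fin d → ℕ) : Type :=
  Matrix (BlockIndex q) (BlockIndex q) ℂ

/-- The `(k, l)`-th block of a block matrix. -/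
def BlockMatrix.block {d : ℕ} {q : Fin d → ℕ} (A : BlockMatrix q) (k l : Fin d) :
    Matrix (Fin (q k)) (Fin (q l)) ℂ :=
  A.submatrix (fun i => ⟨k, i⟩) (fun j => ⟨l, j⟩)

/-- The extension of a `q u × q v` matrix `M`: the block matrix with `(u, v)`-th block `M`
and all other blocks zero. -/
def blockExtend {d : ℕ} (q : Fin d → ℕ) (u v : Fin d) (M : Matrix (Fin (q u)) (Fin (q v)) ℂ) :
    BlockMatrix q :=
  Matrix.of fun x y =>
    if h : x.1 = u ∧ y.1 = v then
      M (Fin.cast (congrArg q h.1) x.2) (Fin.cast (congrArg q h.2) y.2)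
    else 0

/-- The projector `p_k`: the extension of the identity matrix of size `q k`. -/
def blockProj {d : ℕ} (q : Fin d → ℕ) (k : Fin d) : BlockMatrix q :=
  blockExtend q k k 1

/-- `A` is almost diagonal of type `(u, v)`: it is the extension of a (rectangular) diagonal
matrix of size `q u × q v`. -/
def IsAlmostDiagonal {d : ℕ} (q : Fin d → ℕ) (u v : Fin d) (A : BlockMatrix q) : Prop :=
  ∃ M : Matrix (Fin (q u)) (Fin (q v)) ℂ,
    (∀ (i : Fin (q u)) (j : Fin (q v)), (i : ℕ) ≠ (j : ℕ) → M i j = 0) ∧ A = blockExtend q u v M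

/-- The conditional expectation onto the span of the projectors `p_k`, identified with `ℂ^d`:
the `k`-th coordinate is the normalized trace of the `k`-th diagonal block. -/
noncomputable def condE {d : ℕ} (q : Fin d → ℕ) (A : BlockMatrix q) : Fin d → ℂ :=
  fun k => (q k : ℂ)⁻¹ * (A.block k k).trace

/-- The operator norm of a square matrix, for the canonical Hermitian norm. -/
noncomputable def matrixOpNorm {ι : Type*} [Fintype ι] [DecidableEq ι] (A : Matrix ι ι ℂ) : ℝ :=
  ‖Matrix.toEuclideanCLM (𝕜 := ℂ) A‖

/-- Block matrices whose `(k, k)`-th block is unitary and whose other blocks are zero. -/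
def blockUnitarySet {d : ℕ} (q : Fin d → ℕ) (k : Fin d) : Set (BlockMatrix q) :=
  {A | A.block k k ∈ Matrix.unitaryGroup (Fin (q k)) ℂ ∧
    ∀ i j : Fin d, ¬(i = k ∧ j = k) → A.block i j = 0}

theorem blockExtend_mul {d : ℕ} (q : Fin d → ℕ) (k : Fin d)
    (M N : Matrix (Fin (q k)) (Fin (q k)) ℂ) :
    blockExtend q k k M * blockExtend q k k N = blockExtend q k k (M * N) := by
  ext ⟨a, i⟩ ⟨b, j⟩
  simp only [Matrix.mul_apply, blockExtend, Matrix.of_apply, Fintype.sum_sigma]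
  rw [Finset.sum_eq_single k]
  · by_cases ha : a = k
    · subst ha
      by_cases hb : b = a
      · subst hb; simp
      · simp [hb]
    · simp [ha]
  · intro c _ hc
    simp [hc]
  · simp

theorem blockExtend_conjTranspose {d : ℕ} (q : Fin d → ℕ) (k : Fin d)
    (M : Matrix (Fin (q k)) (Fin (q k)) ℂ) :
    (blockExtend q k k M).conjTranspose = blockExtend q k k M.conjTranspose := by
  ext ⟨a, i⟩ ⟨b, j⟩
  simp only [Matrix.conjTranspose_apply, blockExtend, Matrix.of_apply]
  by_cases ha : a = k
  · by_cases hb : b = k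
    · simp [ha, hb]
    · simp [ha, hb]
  · simp [ha]

theorem mem_blockUnitarySet_iff {d : ℕ} (q : Fin d → ℕ) (k : Fin d) (A : BlockMatrix q) :
    A ∈ blockUnitarySet q k ↔
      ∃ U ∈ Matrix.unitaryGroup (Fin (q k)) ℂ, A = blockExtend q k k U := by
  constructor
  · rintro ⟨h1, h2⟩
    refine ⟨_, h1, ?_⟩
    ext ⟨a, i⟩ ⟨b, j⟩
    simp only [blockExtend, Matrix.of_apply]
    by_cases h : a = k ∧ b = k
    · obtain ⟨rfl, rfl⟩ := h
      simp [BlockMatrix.block]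
    · simpa [h, BlockMatrix.block] using congrFun (congrFun (h2 a b h) i) j
  · rintro ⟨U, hU, rfl⟩
    refine ⟨?_, ?_⟩
    · have : (blockExtend q k k U).block k k = U := by
        ext i j; simp [BlockMatrix.block, blockExtend]
      rwa [this]
    · intro a b h
      ext i j
      simp [BlockMatrix.block, blockExtend, h]

/-- The group `𝕌_k` of block matrices whose `(k, k)`-th block is unitary and whose other blocks
are zero, as a type. -/
def BlockUnitary {d : ℕ} (q : Fin d → ℕ) (k : Fin d) : Type :=
  {A : BlockMatrix q // A ∈ blockUnitarySet q k}

/-- The underlying matrix of an element of `𝕌_k`. -/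
def BlockUnitary.toMatrix {d : ℕ} {q : Fin d → ℕ} {k : Fin d} (V : BlockUnitary q k) :
    BlockMatrix q := V.1

/-- `𝕌_k` is a group for matrix multiplication; its unit is `p_k` and the inverse is the adjoint. -/
noncomputable instance BlockUnitary.instGroup {d : ℕ} (q : Fin d → ℕ) (k : Fin d) :
    Group (BlockUnitary q k) where
  mul V W := ⟨V.1 * W.1, by
    obtain ⟨U, hU, h⟩ := (mem_blockUnitarySet_iff q k V.1).1 V.2
    obtain ⟨U', hU', h'⟩ := (mem_blockUnitarySet_iff q k W.1).1 W.2
    exact (mem_blockUnitarySet_iff q k _).2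
      ⟨U * U', mul_mem hU hU', by rw [h, h', blockExtend_mul]⟩⟩
  one := ⟨blockProj q k, (mem_blockUnitarySet_iff q k _).2 ⟨1, one_mem _, rfl⟩⟩
  inv V := ⟨V.1.conjTranspose, by
    obtain ⟨U, hU, h⟩ := (mem_blockUnitarySet_iff q k V.1).1 V.2
    exact (mem_blockUnitarySet_iff q k _).2
      ⟨star U, Unitary.star_mem hU, by
        rw [h, blockExtend_conjTranspose, Matrix.star_eq_conjTranspose]⟩⟩
  mul_assoc _ _ _ := Subtype.ext (Matrix.mul_assoc _ _ _)
  one_mul V := Subtype.ext (by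
    obtain ⟨U, _, h⟩ := (mem_blockUnitarySet_iff q k V.1).1 V.2
    change blockProj q k * V.1 = V.1
    rw [h, blockProj, blockExtend_mul, one_mul])
  mul_one V := Subtype.ext (by
    obtain ⟨U, _, h⟩ := (mem_blockUnitarySet_iff q k V.1).1 V.2
    change V.1 * blockProj q k = V.1
    rw [h, blockProj, blockExtend_mul, mul_one])
  inv_mul_cancel V := Subtype.ext (by
    obtain ⟨U, hU, h⟩ := (mem_blockUnitarySet_iff q k V.1).1 V.2
    change V.1.conjTranspose * V.1 = blockProj q k
    rw [h, blockExtend_conjTranspose, blockExtend_mul, ← Matrix.star_eq_conjTranspose,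
      Unitary.star_mul_self_of_mem hU, blockProj])

/-- The topology of `𝕌_k` is induced by that of matrices. -/
noncomputable instance BlockUnitary.instTopologicalSpace {d : ℕ} (q : Fin d → ℕ) (k : Fin d) :
    TopologicalSpace (BlockUnitary q k) :=
  TopologicalSpace.induced BlockUnitary.toMatrix (inferInstance : TopologicalSpace (BlockMatrix q))

/-- `𝕌_k` carries its Borel `σ`-algebra. -/
noncomputable instance BlockUnitary.instMeasurableSpace {d : ℕ} (q : Fin d → ℕ) (k : Fin d) :
    MeasurableSpace (BlockUnitary q k) :=
  borel _

instance BlockUnitary.instBorelSpace {d : ℕ} (q : Fin d → ℕ) (k : Fin d) :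
    BorelSpace (BlockUnitary q k) := ⟨rfl⟩

/-- A random element of `𝕌_k` is uniform if its law is the Haar probability measure. -/
def IsUniformBlockUnitary {d : ℕ} (q : Fin d → ℕ) (k : Fin d) {Ω : Type*} [MeasurableSpace Ω]
    (P : Measure Ω) (V : Ω → BlockUnitary q k) : Prop :=
  Measurable V ∧ (P.map V).IsHaarMeasure

/-- Condition (i): for one fixed `u`, the matrix `D n` is the projector `p_u(n)` for all `n`. -/
def IsProjectorSeq {d : ℕ} (q : ℕ → Fin d → ℕ) (D : (n : ℕ) → BlockMatrix (q n)) : Prop :=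
  ∃ u : Fin d, ∀ n, D n = blockProj (q n) u

/-- Condition (ii): for fixed `u, v`, the matrix `D n` is almost diagonal of type `(u, v)` for all
`n`, and the conditional expectation of `D n` tends to `0`. -/
def IsCenteredAlmostDiagonalSeq {d : ℕ} (q : ℕ → Fin d → ℕ)
    (D : (n : ℕ) → BlockMatrix (q n)) : Prop :=
  (∃ u v : Fin d, ∀ n, IsAlmostDiagonal (q n) u v (D n)) ∧
    Tendsto (fun n => condE (q n) (D n)) atTop (𝓝 0)

/-- The alternating product `V_1^{m_1} D_1 V_2^{m_2} D_2 ⋯ V_N^{m_N} D_N`, where `V_r` is an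
element of the group `𝕌_{k_r}`, in which the powers are taken. -/
noncomputable def alternatingProduct {d : ℕ} (q : Fin d → ℕ) {N : ℕ} (k : Fin N → Fin d)
    (V : (r : Fin N) → BlockUnitary q (k r)) (m : Fin N → ℤ) (D : Fin N → BlockMatrix q) :
    BlockMatrix q :=
  (List.ofFn fun r : Fin N => (V r ^ m r).toMatrix * D r).prod

/-! The proof runs on loop (Schwinger–Dyson) equations for Haar unitaries. Powers are expanded, so
the product becomes a word in letters `v a` or their adjoints, each followed by a deterministic
bounded matrix. Call a word reduced if, wherever a letter is followed by its own adjoint or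
conversely, the matrix between them has normalized trace tending to zero on the block of that
letter. The hypotheses on the `D r` make the word of the theorem reduced. The core,
`isNegligible_trace_eval`, says that for a nonempty reduced word `W` and bounded deterministic `B`,
the normalized trace `τ = tr (W p_j B) / q_j` tends to zero in `L¹`. Markov's inequality then gives
convergence in probability.

By independence the law of the whole family is a product of Haar measures, hence invariant when one
`v b` is multiplied on the left by `exp (tY)`, with `Y` skew-adjoint. Differentiating the
expectation of a product of one trace and one conjugated trace at `t = 0` gives an identity, which
extends complex-linearly to every `Y` in the block. Take `b` to be the first letter of `W`, take for
`Y` the matrix units of its block, insert the transposed units in the first trace, and sum. There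
are three contributions: the first letter gives `± q_b |tr (W p_j B)|²`; every later occurrence of
`v b` or its adjoint splits the trace into a product of two traces, multiplied by the conjugate of
`tr (W p_j B)`; the derivative of the conjugated trace collapses to single traces, of order `q_j`
only. Dividing by `q_b q_j²` bounds `E |τ|²` by a constant times the `L¹` norm of the normalized
split terms, plus `O(1 / (q_b q_j))`.

In each split term the second trace, over `q_j`, stays bounded because it contains `p_j`. The first,
over `q_b`, is the trace of a strictly shorter reduced word, or, when a letter and its adjoint
cancel across a single matrix, the normalized trace of that matrix, which tends to zero. Strong
induction on the length closes the argument. `exists_loopEquation` is the analytic input,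
`isNegligible_splitSum` the combinatorial one. -/

section UnitaryWords

open scoped Matrix.Norms.L2Operator Matrix ComplexConjugate ENNReal

/-! ### Traces, norms and matrix units of block matrices; the unitary groups of the blocks -/

section BlockMatrixLemmas

variable {d : ℕ} {q : Fin d → ℕ}

theorem blockProj_apply (k : Fin d) (x y : BlockIndex q) :
    blockProj q k x y = if x = y ∧ x.1 = k then 1 else 0 := by
  obtain ⟨a, i⟩ := x
  obtain ⟨b, j⟩ := y
  simp only [blockProj, blockExtend, Matrix.of_apply, Matrix.one_apply]
  by_cases ha : a = k
  · subst ha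
    by_cases hb : b = a
    · subst hb; simp
    · simp [hb, Ne.symm hb]
  · simp [ha]

theorem blockProj_eq_diagonal (k : Fin d) :
    blockProj q k = Matrix.diagonal fun x : BlockIndex q => if x.1 = k then 1 else 0 := by
  ext x y
  rw [blockProj_apply, Matrix.diagonal_apply]
  by_cases h : x = y <;> simp [h]

theorem norm_blockProj_le (k : Fin d) : ‖blockProj q k‖ ≤ 1 := by
  rw [blockProj_eq_diagonal, Matrix.l2_opNorm_diagonal]
  refine (pi_norm_le_iff_of_nonneg zero_le_one).2 fun x => ?_
  split_ifs <;> simp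

theorem norm_entry_le_l2_opNorm {ι : Type*} [Fintype ι] [DecidableEq ι] (A : Matrix ι ι ℂ)
    (i j : ι) : ‖A i j‖ ≤ ‖A‖ := by
  have h := Matrix.l2_opNorm_mulVec A (EuclideanSpace.single j 1)
  have h2 := PiLp.norm_single 2 (fun _ : ι => ℂ) j (1 : ℂ)
  rw [h2, norm_one, mul_one] at h
  refine le_trans ?_ h
  refine le_trans (le_of_eq ?_) (PiLp.norm_apply_le _ i)
  simp

theorem trace_blockProj_mul (k : Fin d) (A : BlockMatrix q) :
    (blockProj q k * A).trace = ∑ i : Fin (q k), A ⟨k, i⟩ ⟨k, i⟩ := by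
  rw [blockProj_eq_diagonal, Matrix.trace]
  simp only [Matrix.diag_apply, Matrix.diagonal_mul, Fintype.sum_sigma]
  rw [Finset.sum_eq_single k]
  · simp
  · intro b _ hb; simp [hb]
  · simp

theorem condE_apply (k : Fin d) (A : BlockMatrix q) :
    condE q A k = (q k : ℂ)⁻¹ * (blockProj q k * A).trace := by
  rw [trace_blockProj_mul]; rfl

theorem norm_trace_blockProj_mul_le (k : Fin d) (A : BlockMatrix q) :
    ‖(blockProj q k * A).trace‖ ≤ q k * ‖A‖ := by
  rw [trace_blockProj_mul]
  refine (norm_sum_le _ _).trans ?_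
  refine (Finset.sum_le_sum fun i _ => norm_entry_le_l2_opNorm A _ _).trans ?_
  simp

theorem trace_blockProj (k : Fin d) : (blockProj q k).trace = q k := by
  have := trace_blockProj_mul k (1 : BlockMatrix q)
  simpa using this

/-- The matrix unit at position `(a, b)` of the `k`-th diagonal block. -/
def blockUnit (q : Fin d → ℕ) (k : Fin d) (a b : Fin (q k)) : BlockMatrix q :=
  Matrix.single ⟨k, a⟩ ⟨k, b⟩ 1

theorem blockUnit_eq_blockExtend (k : Fin d) (a b : Fin (q k)) :
    blockUnit q k a b = blockExtend q k k (Matrix.single a b 1) := by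
  ext ⟨u, i⟩ ⟨v, j⟩
  simp only [blockUnit, blockExtend, Matrix.of_apply, Matrix.single_apply]
  by_cases hu : u = k
  · subst hu
    by_cases hv : v = u
    · subst hv; simp
    · simp [hv, Ne.symm hv]
  · simp [hu, Ne.symm hu]

theorem blockUnit_conjTranspose (k : Fin d) (a b : Fin (q k)) :
    (blockUnit q k a b)ᴴ = blockUnit q k b a := by
  simp [blockUnit]

theorem trace_blockUnit_mul (k : Fin d) (a b : Fin (q k)) (A : BlockMatrix q) :
    (blockUnit q k a b * A).trace = A ⟨k, b⟩ ⟨k, a⟩ := by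
  simp [blockUnit, Matrix.trace_single_mul]

/-- This is the mechanism that splits one trace into two: a transposed pair of matrix units, summed
over a block, disconnects the two arcs of the cyclic product between them. -/
theorem sum_trace_blockUnit_mul_blockUnit_mul (k : Fin d) (A B : BlockMatrix q) :
    ∑ a, ∑ b, (blockUnit q k a b * A * blockUnit q k b a * B).trace =
      (blockProj q k * A).trace * (blockProj q k * B).trace := by
  rw [trace_blockProj_mul, trace_blockProj_mul, Finset.sum_mul_sum, Finset.sum_comm]
  refine Finset.sum_congr rfl fun b _ => Finset.sum_congr rfl fun a _ => ?_
  rw [Matrix.mul_assoc, Matrix.mul_assoc, trace_blockUnit_mul, blockUnit]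
  rw [Matrix.mul_apply, Finset.sum_eq_single ⟨k, b⟩]
  · simp
  · intro x _ hx
    rw [Matrix.single_mul_apply_of_ne, mul_zero]
    exact hx
  · simp

theorem sum_blockUnit_mul_blockUnit (k : Fin d) :
    ∑ a, ∑ b, blockUnit q k b a * blockUnit q k a b = (q k : ℂ) • blockProj q k := by
  have h1 : ∑ b, blockUnit q k b b = blockProj q k := by
    simp only [blockUnit_eq_blockExtend]
    ext x y
    rw [Matrix.sum_apply]
    simp only [blockProj, blockExtend, Matrix.of_apply]
    split_ifs
    · rw [← Matrix.sum_apply, Matrix.sum_single_one]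
    · simp
  have h2 : ∀ a b, blockUnit q k b a * blockUnit q k a b = blockUnit q k b b := by
    intro a b; simp [blockUnit]
  simp only [h2, h1, Finset.sum_const, Finset.card_univ, Fintype.card_fin]
  rw [Nat.cast_smul_eq_nsmul]

/-- The units of a block are orthonormal for the Hilbert–Schmidt product, so the double sum is an
inner product, that is, a single trace. The conjugated part of the loop equation is therefore of
lower order than the split terms. -/
theorem sum_trace_blockUnit_mul_conj (k : Fin d) (A B : BlockMatrix q) :
    ∑ a, ∑ b, (blockUnit q k a b * A).trace * conj (blockUnit q k a b * B).trace =
      (A * (blockProj q k * Bᴴ * blockProj q k)).trace := by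
  rw [← Matrix.mul_assoc, Matrix.trace_mul_comm, trace_blockProj_mul]
  rw [Finset.sum_comm]
  refine Finset.sum_congr rfl fun a _ => ?_
  simp only [trace_blockUnit_mul]
  rw [blockProj_eq_diagonal, Matrix.mul_apply, Fintype.sum_sigma, Finset.sum_eq_single k]
  · simp [Matrix.diagonal_mul]
  · intro c _ hc
    simp [Matrix.diagonal_mul, hc]
  · simp

theorem norm_sum_trace_blockUnit_mul_conj_le (k : Fin d) (A B : BlockMatrix q) {α : ℝ}
    (hα : ∀ M : BlockMatrix q, ‖(A * M).trace‖ ≤ α * ‖M‖) (hα0 : 0 ≤ α) :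
    ‖∑ a, ∑ b, (blockUnit q k a b * A).trace * conj (blockUnit q k a b * B).trace‖ ≤
      α * ‖B‖ := by
  rw [sum_trace_blockUnit_mul_conj]
  refine (hα _).trans (mul_le_mul_of_nonneg_left ?_ hα0)
  refine (norm_mul_le _ _).trans (le_trans (mul_le_mul (norm_mul_le _ _) (norm_blockProj_le k)
    (norm_nonneg _) (by positivity)) ?_)
  rw [mul_one, Matrix.l2_opNorm_conjTranspose]
  exact mul_le_of_le_one_left (norm_nonneg _) (norm_blockProj_le k)

namespace BlockUnitary

variable {k : Fin d}

theorem conjTranspose_mul_self (V : BlockUnitary q k) :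
    V.toMatrixᴴ * V.toMatrix = blockProj q k :=
  congrArg BlockUnitary.toMatrix (inv_mul_cancel V)

theorem blockProj_mul (V : BlockUnitary q k) : blockProj q k * V.toMatrix = V.toMatrix :=
  congrArg BlockUnitary.toMatrix (one_mul V)

theorem mul_blockProj (V : BlockUnitary q k) : V.toMatrix * blockProj q k = V.toMatrix :=
  congrArg BlockUnitary.toMatrix (mul_one V)

theorem toMatrix_mul (V W : BlockUnitary q k) : (V * W).toMatrix = V.toMatrix * W.toMatrix := rfl

theorem toMatrix_inv (V : BlockUnitary q k) : (V⁻¹).toMatrix = V.toMatrixᴴ := rfl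

theorem blockProj_mul_conjTranspose (V : BlockUnitary q k) :
    blockProj q k * V.toMatrixᴴ = V.toMatrixᴴ := blockProj_mul V⁻¹

theorem conjTranspose_mul_blockProj (V : BlockUnitary q k) :
    V.toMatrixᴴ * blockProj q k = V.toMatrixᴴ := mul_blockProj V⁻¹

theorem norm_toMatrix_le (V : BlockUnitary q k) : ‖V.toMatrix‖ ≤ 1 := by
  have h := Matrix.l2_opNorm_conjTranspose_mul_self V.toMatrix
  rw [conjTranspose_mul_self] at h
  have := norm_blockProj_le (q := q) k
  nlinarith [norm_nonneg V.toMatrix]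

theorem continuous_toMatrix : Continuous (toMatrix : BlockUnitary q k → BlockMatrix q) :=
  continuous_induced_dom

theorem stronglyMeasurable_toMatrix :
    StronglyMeasurable (toMatrix : BlockUnitary q k → BlockMatrix q) :=
  continuous_toMatrix.stronglyMeasurable

theorem measurable_const_mul (g : BlockUnitary q k) :
    Measurable fun V : BlockUnitary q k => g * V := by
  refine Continuous.measurable (continuous_induced_rng.2 ?_)
  exact continuous_const.mul continuous_toMatrix

end BlockUnitary

/-- The extension of a square matrix by zero, as a linear map. -/
def blockExtendLinear (q : Fin d → ℕ) (k : Fin d) :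
    Matrix (Fin (q k)) (Fin (q k)) ℂ →ₗ[ℝ] BlockMatrix q where
  toFun := blockExtend q k k
  map_add' M N := by
    ext x y; simp only [blockExtend, Matrix.of_apply, Matrix.add_apply]; split_ifs <;> simp
  map_smul' c M := by
    ext x y; simp only [blockExtend, Matrix.of_apply, Matrix.smul_apply]; split_ifs <;> simp

/-- The element `exp (t Y)` of `𝕌_k`, for a skew-adjoint matrix `Y`. -/
noncomputable def BlockUnitary.expSkew (q : Fin d → ℕ) (k : Fin d)
    (Y : skewAdjoint (Matrix (Fin (q k)) (Fin (q k)) ℂ)) (t : ℝ) : BlockUnitary q k :=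
  ⟨blockExtend q k k (NormedSpace.exp (t • (Y : Matrix (Fin (q k)) (Fin (q k)) ℂ))),
    letI : NormedAlgebra ℚ (Matrix (Fin (q k)) (Fin (q k)) ℂ) := NormedAlgebra.restrictScalars ℚ ℂ _
    (mem_blockUnitarySet_iff q k _).2 ⟨_, NormedSpace.exp_mem_unitary_of_mem_skewAdjoint
      (skewAdjoint.smul_mem t Y.2), rfl⟩⟩

theorem BlockUnitary.hasDerivAt_expSkew_mul (k : Fin d)
    (Y : skewAdjoint (Matrix (Fin (q k)) (Fin (q k)) ℂ)) (V : BlockUnitary q k) (t : ℝ) :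
    HasDerivAt (fun t => (expSkew q k Y t * V).toMatrix)
      (blockExtend q k k Y * (expSkew q k Y t * V).toMatrix) t := by
  have h := hasDerivAt_exp_smul_const' (𝕂 := ℝ) (Y : Matrix (Fin (q k)) (Fin (q k)) ℂ) t
  have h2 := ((blockExtendLinear q k).toContinuousLinearMap.hasFDerivAt
    (x := NormedSpace.exp (t • (Y : Matrix (Fin (q k)) (Fin (q k)) ℂ)))).comp_hasDerivAt t h
  have h3 := h2.mul_const V.toMatrix
  refine h3.congr_deriv ?_
  change blockExtend q k k _ * _ = _
  rw [← blockExtend_mul, Matrix.mul_assoc]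
  rfl

end BlockMatrixLemmas

/-! ### Words in unitary matrices and their derivatives -/

section Words

variable {d : ℕ}

/-- Families of block unitary matrices, indexed as in the main theorem. -/
abbrev UnitaryFamily (q : Fin d → ℕ) : Type := (a : ℕ × Fin d) → BlockUnitary q a.2

/-- Words in the unitary matrices of a family, their adjoints, and deterministic matrices. -/
abbrev UnitaryWord (q : Fin d → ℕ) : Type := List ((ℕ × Fin d) × Bool × BlockMatrix q)

variable {q : Fin d → ℕ}

namespace UnitaryFamily

/-- A unitary matrix of the family, or its adjoint. -/
noncomputable def letter (v : UnitaryFamily q) (a : ℕ × Fin d) (ε : Bool) : BlockMatrix q :=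
  if ε then (v a).toMatrix else (v a).toMatrixᴴ

/-- The derivative of a letter when `v b` moves in the direction `Y * v b`. -/
noncomputable def letterDeriv (v : UnitaryFamily q) (b : ℕ × Fin d) (Y : BlockMatrix q)
    (a : ℕ × Fin d) (ε : Bool) : BlockMatrix q :=
  if a = b then (if ε then Y * (v a).toMatrix else -((v a).toMatrixᴴ * Y)) else 0

/-- The value of a word. -/
noncomputable def eval (v : UnitaryFamily q) : UnitaryWord q → BlockMatrix q
  | [] => 1
  | x :: w => v.letter x.1 x.2.1 * x.2.2 * v.eval w

/-- The derivative of the value of a word when `v b` moves in the direction `Y * v b`. -/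
noncomputable def evalDeriv (v : UnitaryFamily q) (b : ℕ × Fin d) (Y : BlockMatrix q) :
    UnitaryWord q → BlockMatrix q
  | [] => 0
  | x :: w => v.letterDeriv b Y x.1 x.2.1 * x.2.2 * v.eval w +
      v.letter x.1 x.2.1 * x.2.2 * v.evalDeriv b Y w

theorem eval_append (v : UnitaryFamily q) (w w' : UnitaryWord q) :
    v.eval (w ++ w') = v.eval w * v.eval w' := by
  induction w with
  | nil => simp [eval]
  | cons x w ih => simp [eval, ih, Matrix.mul_assoc]

theorem blockProj_mul_letter (v : UnitaryFamily q) (a : ℕ × Fin d) (ε : Bool) :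
    blockProj q a.2 * v.letter a ε = v.letter a ε := by
  unfold letter
  split_ifs
  · exact (v a).blockProj_mul
  · exact (v a).blockProj_mul_conjTranspose

theorem letter_mul_blockProj (v : UnitaryFamily q) (a : ℕ × Fin d) (ε : Bool) :
    v.letter a ε * blockProj q a.2 = v.letter a ε := by
  unfold letter
  split_ifs
  · exact (v a).mul_blockProj
  · exact (v a).conjTranspose_mul_blockProj

theorem norm_letter_le (v : UnitaryFamily q) (a : ℕ × Fin d) (ε : Bool) : ‖v.letter a ε‖ ≤ 1 := by
  unfold letter
  split_ifs
  · exact (v a).norm_toMatrix_le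
  · rw [Matrix.l2_opNorm_conjTranspose]; exact (v a).norm_toMatrix_le

theorem norm_letterDeriv_le (v : UnitaryFamily q) (b : ℕ × Fin d) (Y : BlockMatrix q)
    (a : ℕ × Fin d) (ε : Bool) : ‖v.letterDeriv b Y a ε‖ ≤ ‖Y‖ := by
  have h := (v a).norm_toMatrix_le
  unfold letterDeriv
  split_ifs
  · exact (norm_mul_le _ _).trans (mul_le_of_le_one_right (norm_nonneg _) h)
  · rw [norm_neg]
    refine (norm_mul_le _ _).trans (mul_le_of_le_one_left (norm_nonneg _) ?_)
    rwa [Matrix.l2_opNorm_conjTranspose]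
  · simp

theorem norm_letter_mul_le (v : UnitaryFamily q) (a : ℕ × Fin d) (ε : Bool) {D : BlockMatrix q}
    {C : ℝ} (hD : ‖D‖ ≤ C) : ‖v.letter a ε * D‖ ≤ C :=
  (norm_mul_le _ _).trans
    ((mul_le_of_le_one_left (norm_nonneg _) (v.norm_letter_le a ε)).trans hD)

/-- Only an inequality: all blocks may be empty, and then the norm is zero. -/
theorem norm_one_le : ‖(1 : BlockMatrix q)‖ ≤ 1 := by
  rw [← Matrix.diagonal_one, Matrix.l2_opNorm_diagonal]
  exact (pi_norm_le_iff_of_nonneg zero_le_one).2 fun x => by simp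

theorem norm_eval_le (v : UnitaryFamily q) (w : UnitaryWord q) {C : ℝ} (hC : 0 ≤ C)
    (hw : ∀ x ∈ w, ‖x.2.2‖ ≤ C) : ‖v.eval w‖ ≤ C ^ w.length := by
  induction w with
  | nil => simpa [eval] using norm_one_le
  | cons x w ih =>
    rw [List.forall_mem_cons] at hw
    rw [eval, List.length_cons, pow_succ']
    exact (norm_mul_le _ _).trans (mul_le_mul (v.norm_letter_mul_le _ _ hw.1) (ih hw.2)
      (norm_nonneg _) hC)

theorem norm_evalDeriv_le (v : UnitaryFamily q) (b : ℕ × Fin d) (Y : BlockMatrix q)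
    (w : UnitaryWord q) {C : ℝ} (hC : 0 ≤ C) (hw : ∀ x ∈ w, ‖x.2.2‖ ≤ C) :
    ‖v.evalDeriv b Y w‖ ≤ w.length * (‖Y‖ * C ^ w.length) := by
  induction w with
  | nil => simp [evalDeriv]
  | cons x w ih =>
    rw [List.forall_mem_cons] at hw
    have h1 : ‖v.letterDeriv b Y x.1 x.2.1 * x.2.2 * v.eval w‖ ≤ ‖Y‖ * C * C ^ w.length := by
      refine (norm_mul_le _ _).trans (mul_le_mul ((norm_mul_le _ _).trans (mul_le_mul
        (v.norm_letterDeriv_le b Y _ _) hw.1 (norm_nonneg _) (norm_nonneg _)))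
        (v.norm_eval_le w hC hw.2) (norm_nonneg _) (by positivity))
    have h2 : ‖v.letter x.1 x.2.1 * x.2.2 * v.evalDeriv b Y w‖ ≤
        C * (w.length * (‖Y‖ * C ^ w.length)) :=
      (norm_mul_le _ _).trans (mul_le_mul (v.norm_letter_mul_le _ _ hw.1) (ih hw.2)
        (norm_nonneg _) hC)
    rw [evalDeriv]
    refine (norm_add_le _ _).trans ((add_le_add h1 h2).trans (le_of_eq ?_))
    push_cast [List.length_cons]
    ring

theorem stronglyMeasurable_letter (a : ℕ × Fin d) (ε : Bool) :
    StronglyMeasurable fun v : UnitaryFamily q => v.letter a ε := by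
  have h : StronglyMeasurable fun v : UnitaryFamily q => (v a).toMatrix :=
    BlockUnitary.stronglyMeasurable_toMatrix.comp_measurable (measurable_pi_apply a)
  unfold letter
  cases ε
  · simpa using (continuous_id.matrix_conjTranspose).comp_stronglyMeasurable h
  · simpa using h

theorem stronglyMeasurable_letterDeriv (b : ℕ × Fin d) (Y : BlockMatrix q) (a : ℕ × Fin d)
    (ε : Bool) : StronglyMeasurable fun v : UnitaryFamily q => v.letterDeriv b Y a ε := by
  unfold letterDeriv
  split_ifs with h1 h2
  · simpa [letter, h2] using (stronglyMeasurable_letter (q := q) a true).const_mul Y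
  · simpa [letter, Pi.neg_def] using ((stronglyMeasurable_letter (q := q) a false).mul_const Y).neg
  · exact stronglyMeasurable_const

theorem stronglyMeasurable_eval (w : UnitaryWord q) :
    StronglyMeasurable fun v : UnitaryFamily q => v.eval w := by
  induction w with
  | nil => exact stronglyMeasurable_const
  | cons x w ih => exact ((stronglyMeasurable_letter _ _).mul_const _).mul ih

theorem stronglyMeasurable_evalDeriv (b : ℕ × Fin d) (Y : BlockMatrix q) (w : UnitaryWord q) :
    StronglyMeasurable fun v : UnitaryFamily q => v.evalDeriv b Y w := by
  induction w with
  | nil => exact stronglyMeasurable_const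
  | cons x w ih =>
    exact (((stronglyMeasurable_letterDeriv b Y _ _).mul_const _).mul
      (stronglyMeasurable_eval w)).add (((stronglyMeasurable_letter _ _).mul_const _).mul ih)

theorem _root_.MeasureTheory.StronglyMeasurable.matrix_trace {α ι : Type*} [Fintype ι]
    [MeasurableSpace α] {f : α → Matrix ι ι ℂ} (hf : StronglyMeasurable f) :
    StronglyMeasurable fun x => (f x).trace :=
  (continuous_id.matrix_trace).comp_stronglyMeasurable hf

theorem evalDeriv_add (v : UnitaryFamily q) (b : ℕ × Fin d) (Y Y' : BlockMatrix q)
    (w : UnitaryWord q) :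
    v.evalDeriv b (Y + Y') w = v.evalDeriv b Y w + v.evalDeriv b Y' w := by
  induction w with
  | nil => simp [evalDeriv]
  | cons x w ih =>
    have : v.letterDeriv b (Y + Y') x.1 x.2.1 =
        v.letterDeriv b Y x.1 x.2.1 + v.letterDeriv b Y' x.1 x.2.1 := by
      unfold letterDeriv; split_ifs
      · exact add_mul _ _ _
      · rw [mul_add, neg_add]
      · simp
    rw [evalDeriv, evalDeriv, evalDeriv, ih, this]
    noncomm_ring

theorem evalDeriv_smul (v : UnitaryFamily q) (b : ℕ × Fin d) (c : ℂ) (Y : BlockMatrix q)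
    (w : UnitaryWord q) : v.evalDeriv b (c • Y) w = c • v.evalDeriv b Y w := by
  induction w with
  | nil => simp [evalDeriv]
  | cons x w ih =>
    have : v.letterDeriv b (c • Y) x.1 x.2.1 = c • v.letterDeriv b Y x.1 x.2.1 := by
      unfold letterDeriv; split_ifs <;> simp
    rw [evalDeriv, evalDeriv, ih, this]
    simp

/-- The Leibniz rule. Skew-adjointness of `Y` turns the derivative `v* Y*` of an adjoint letter into
`-v* Y`, which is the form used in `letterDeriv` and makes `evalDeriv` complex-linear in `Y`. -/
theorem hasDerivAt_eval {v : ℝ → UnitaryFamily q} {b : ℕ × Fin d} {Y : BlockMatrix q}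
    (hY : Yᴴ = -Y) {t : ℝ}
    (hb : HasDerivAt (fun t => (v t b).toMatrix) (Y * (v t b).toMatrix) t)
    (hne : ∀ a, a ≠ b → ∀ s, v s a = v t a) (w : UnitaryWord q) :
    HasDerivAt (fun t => (v t).eval w) ((v t).evalDeriv b Y w) t := by
  induction w with
  | nil => exact hasDerivAt_const _ _
  | cons x w ih =>
    have h : HasDerivAt (fun t => (v t).letter x.1 x.2.1)
        ((v t).letterDeriv b Y x.1 x.2.1) t := by
      by_cases hx : x.1 = b
      · unfold letter letterDeriv
        rw [hx, if_pos rfl]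
        split_ifs
        · exact hb
        · refine hb.star.congr_deriv ?_
          rw [Matrix.star_eq_conjTranspose, Matrix.conjTranspose_mul, hY, mul_neg]
      · have h0 : (v t).letterDeriv b Y x.1 x.2.1 = 0 := if_neg hx
        rw [h0]
        have : (fun t => (v t).letter x.1 x.2.1) = fun _ => (v t).letter x.1 x.2.1 := by
          funext s
          unfold letter
          rw [hne _ hx s]
        rw [this]
        exact hasDerivAt_const _ _
    exact ((h.mul_const x.2.2).mul ih)

end UnitaryFamily
end Words

/-! ### Integration by parts for Haar unitaries -/

section SchwingerDyson

/-- Bounded measurable complex-valued functions. -/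
def IsBoundedMeasurable {α : Type*} [MeasurableSpace α] (f : α → ℂ) : Prop :=
  StronglyMeasurable f ∧ ∃ K : ℝ, ∀ x, ‖f x‖ ≤ K

namespace IsBoundedMeasurable

variable {α : Type*} [MeasurableSpace α] {f g : α → ℂ}

theorem integrable (hf : IsBoundedMeasurable f) (μ : Measure α) [IsFiniteMeasure μ] :
    Integrable f μ := by
  obtain ⟨h, K, hK⟩ := hf
  exact Integrable.of_bound h.aestronglyMeasurable K (ae_of_all _ hK)

theorem mul (hf : IsBoundedMeasurable f) (hg : IsBoundedMeasurable g) :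
    IsBoundedMeasurable fun x => f x * g x := by
  obtain ⟨hf, K, hK⟩ := hf
  obtain ⟨hg, K', hK'⟩ := hg
  refine ⟨hf.mul hg, K * K', fun x => ?_⟩
  rw [norm_mul]
  exact mul_le_mul (hK x) (hK' x) (norm_nonneg _) ((norm_nonneg _).trans (hK x))

theorem add (hf : IsBoundedMeasurable f) (hg : IsBoundedMeasurable g) :
    IsBoundedMeasurable fun x => f x + g x := by
  obtain ⟨hf, K, hK⟩ := hf
  obtain ⟨hg, K', hK'⟩ := hg
  exact ⟨hf.add hg, K + K', fun x => (norm_add_le _ _).trans (add_le_add (hK x) (hK' x))⟩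

theorem comp_conj (hf : IsBoundedMeasurable f) : IsBoundedMeasurable fun x => conj (f x) := by
  obtain ⟨hf, K, hK⟩ := hf
  exact ⟨Complex.continuous_conj.comp_stronglyMeasurable hf, K, fun x => by
    rw [RCLike.norm_conj]; exact hK x⟩

theorem sum {ι : Type*} {s : Finset ι} {f : ι → α → ℂ} (hf : ∀ i ∈ s, IsBoundedMeasurable (f i)) :
    IsBoundedMeasurable fun x => ∑ i ∈ s, f i x := by
  classical
  induction s using Finset.induction_on with
  | empty => exact ⟨by simpa using stronglyMeasurable_const, 0, by simp⟩
  | insert i s hi ih =>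
    simp only [Finset.sum_insert hi]
    exact (hf i (by simp)).add (ih fun j hj => hf j (by simp [hj]))

end IsBoundedMeasurable

variable {d : ℕ} {q : Fin d → ℕ}

theorem norm_trace_le {ι : Type*} [Fintype ι] [DecidableEq ι] (A : Matrix ι ι ℂ) :
    ‖A.trace‖ ≤ Fintype.card ι * ‖A‖ := by
  refine (norm_sum_le _ _).trans ?_
  refine (Finset.sum_le_sum fun i _ => norm_entry_le_l2_opNorm A i i).trans ?_
  simp

theorem isBoundedMeasurable_trace {α ι : Type*} [MeasurableSpace α] [Fintype ι] [DecidableEq ι]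
    {f : α → Matrix ι ι ℂ} (hf : StronglyMeasurable f) {K : ℝ} (hK : ∀ x, ‖f x‖ ≤ K) :
    IsBoundedMeasurable fun x => (f x).trace :=
  ⟨hf.matrix_trace, Fintype.card ι * K, fun x => (norm_trace_le _).trans
    (mul_le_mul_of_nonneg_left (hK x) (Nat.cast_nonneg _))⟩

namespace UnitaryFamily

theorem exists_norm_le (w : UnitaryWord q) : ∃ C : ℝ, 0 ≤ C ∧ ∀ x ∈ w, ‖x.2.2‖ ≤ C := by
  induction w with
  | nil => exact ⟨0, le_rfl, by simp⟩
  | cons x w ih =>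
    obtain ⟨C, hC, hw⟩ := ih
    refine ⟨max C ‖x.2.2‖, le_max_of_le_left hC, List.forall_mem_cons.2
      ⟨le_max_right _ _, fun y hy => (hw y hy).trans (le_max_left _ _)⟩⟩

theorem isBoundedMeasurable_trace_eval (X Q : BlockMatrix q) (w : UnitaryWord q) :
    IsBoundedMeasurable fun v : UnitaryFamily q => (X * v.eval w * Q).trace := by
  obtain ⟨C, hC, hw⟩ := exists_norm_le w
  refine isBoundedMeasurable_trace (((stronglyMeasurable_eval w).const_mul X).mul_const Q)
    (K := ‖X‖ * C ^ w.length * ‖Q‖) fun v => ?_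
  exact (norm_mul_le _ _).trans (mul_le_mul_of_nonneg_right ((norm_mul_le _ _).trans
    (mul_le_mul_of_nonneg_left (v.norm_eval_le w hC hw) (norm_nonneg _))) (norm_nonneg _))

theorem isBoundedMeasurable_trace_evalDeriv (X Q : BlockMatrix q) (b : ℕ × Fin d)
    (Y : BlockMatrix q) (w : UnitaryWord q) :
    IsBoundedMeasurable fun v : UnitaryFamily q => (X * v.evalDeriv b Y w * Q).trace := by
  obtain ⟨C, hC, hw⟩ := exists_norm_le w
  refine isBoundedMeasurable_trace (((stronglyMeasurable_evalDeriv b Y w).const_mul X).mul_const Q)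
    (K := ‖X‖ * (w.length * (‖Y‖ * C ^ w.length)) * ‖Q‖) fun v => ?_
  exact (norm_mul_le _ _).trans (mul_le_mul_of_nonneg_right ((norm_mul_le _ _).trans
    (mul_le_mul_of_nonneg_left (v.norm_evalDeriv_le b Y w hC hw) (norm_nonneg _)))
    (norm_nonneg _))

/-- The law of a family of unitary matrices is invariant under left translation of each matrix. -/
def IsTranslationInvariant (μ : Measure (UnitaryFamily q)) : Prop :=
  ∀ (b : ℕ × Fin d) (g : BlockUnitary q b.2),
    MeasurePreserving (fun v : UnitaryFamily q => Function.update v b (g * v b)) μ μ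

/-- The derivative of `tr (X w Q) * conj (tr (w' Q'))` when `v b` moves in the direction `Y * v b`,
extended `ℂ`-linearly from skew-adjoint `Y`. -/
noncomputable def tracePairDeriv (v : UnitaryFamily q) (b : ℕ × Fin d) (X Q Q' : BlockMatrix q)
    (w w' : UnitaryWord q) (Y : BlockMatrix q) : ℂ :=
  (X * v.evalDeriv b Y w * Q).trace * conj (1 * v.eval w' * Q').trace +
    (X * v.eval w * Q).trace * conj (1 * v.evalDeriv b (-Yᴴ) w' * Q').trace

theorem isBoundedMeasurable_tracePairDeriv (b : ℕ × Fin d) (X Q Q' : BlockMatrix q)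
    (w w' : UnitaryWord q) (Y : BlockMatrix q) :
    IsBoundedMeasurable fun v : UnitaryFamily q => v.tracePairDeriv b X Q Q' w w' Y :=
  ((isBoundedMeasurable_trace_evalDeriv _ _ _ _ _).mul
    (isBoundedMeasurable_trace_eval _ _ _).comp_conj).add
    ((isBoundedMeasurable_trace_eval _ _ _).mul
    (isBoundedMeasurable_trace_evalDeriv _ _ _ _ _).comp_conj)

theorem hasDerivAt_trace_mul {ι : Type*} [Fintype ι] [DecidableEq ι] (X Q : Matrix ι ι ℂ)
    {f : ℝ → Matrix ι ι ℂ} {f' : Matrix ι ι ℂ} {t : ℝ} (hf : HasDerivAt f f' t) :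
    HasDerivAt (fun t => (X * f t * Q).trace) (X * f' * Q).trace t := by
  let T : Matrix ι ι ℂ →L[ℝ] ℂ := (Matrix.traceLinearMap ι ℝ ℂ).toContinuousLinearMap
  have h : HasFDerivAt (fun M : Matrix ι ι ℂ => T M) T (X * f t * Q) := T.hasFDerivAt
  exact h.comp_hasDerivAt t ((hf.const_mul X).mul_const Q)

/-- Translation by `exp (tY)` preserves the measure, so the expectation of the product of traces is
constant in `t`. All functions are bounded, which justifies differentiating under the integral. -/
theorem integral_tracePairDeriv_of_skewAdjoint {μ : Measure (UnitaryFamily q)}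
    [IsFiniteMeasure μ] (hμ : IsTranslationInvariant μ) (b : ℕ × Fin d) (X Q Q' : BlockMatrix q)
    (w w' : UnitaryWord q) (Y : skewAdjoint (Matrix (Fin (q b.2)) (Fin (q b.2)) ℂ)) :
    ∫ v, v.tracePairDeriv b X Q Q' w w' (blockExtend q b.2 b.2 Y) ∂μ = 0 := by
  set Z : BlockMatrix q := blockExtend q b.2 b.2 Y with hZ_def
  have hZ : Zᴴ = -Z := by
    rw [hZ_def, blockExtend_conjTranspose, ← Matrix.star_eq_conjTranspose,
      skewAdjoint.mem_iff.1 Y.2]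
    exact map_neg (blockExtendLinear q b.2) _
  let φ : ℝ → UnitaryFamily q → UnitaryFamily q := fun t v =>
    Function.update v b (BlockUnitary.expSkew q b.2 Y t * v b)
  let f : UnitaryFamily q → ℂ := fun v =>
    (X * v.eval w * Q).trace * conj (1 * v.eval w' * Q').trace
  have hf : IsBoundedMeasurable f :=
    (isBoundedMeasurable_trace_eval _ _ _).mul (isBoundedMeasurable_trace_eval _ _ _).comp_conj
  have hφ : ∀ t, MeasurePreserving (φ t) μ μ := fun t => hμ b _
  have hconst : ∀ t, ∫ v, f (φ t v) ∂μ = ∫ v, f v ∂μ := by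
    intro t
    rw [← integral_map (hφ t).aemeasurable hf.1.aestronglyMeasurable, (hφ t).map_eq]
  have hderiv : ∀ v t, HasDerivAt (fun t => f (φ t v)) ((φ t v).tracePairDeriv b X Q Q' w w' Z) t := by
    intro v t
    have hb : HasDerivAt (fun t => (φ t v b).toMatrix) (Z * (φ t v b).toMatrix) t := by
      simp only [φ, Function.update_self]
      exact BlockUnitary.hasDerivAt_expSkew_mul _ _ _ _
    have hne : ∀ a, a ≠ b → ∀ s, φ s v a = φ t v a := by
      intro a ha s
      simp only [φ, Function.update_of_ne ha]
    have h1 := hasDerivAt_trace_mul X Q (hasDerivAt_eval (v := fun t => φ t v) hZ hb hne w)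
    have h2 := (hasDerivAt_trace_mul 1 Q'
      (hasDerivAt_eval (v := fun t => φ t v) hZ hb hne w')).star
    have := h1.mul h2
    unfold tracePairDeriv
    rw [hZ, neg_neg]
    exact this
  obtain ⟨hm, K, hK⟩ := isBoundedMeasurable_tracePairDeriv b X Q Q' w w' Z
  have key := (hasDerivAt_integral_of_dominated_loc_of_deriv_le (μ := μ) (x₀ := (0 : ℝ))
    (s := Set.univ) (bound := fun _ => K)
    (F := fun t v => f (φ t v)) (F' := fun t v => (φ t v).tracePairDeriv b X Q Q' w w' Z)
    univ_mem
    (Eventually.of_forall fun t => (hf.1.comp_measurable (hφ t).measurable).aestronglyMeasurable)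
    ((hφ 0).integrable_comp_of_integrable (hf.integrable μ))
    (hm.comp_measurable (hφ 0).measurable).aestronglyMeasurable
    (ae_of_all _ fun v t _ => hK _) (integrable_const _)
    (ae_of_all _ fun v t _ => hderiv v t)).2
  simp only [hconst] at key
  have h0 := key.unique (hasDerivAt_const _ _)
  -- Invariance under `φ 0` removes it from the integrand, without identifying it with the identity.
  rw [← integral_map (f := fun v => v.tracePairDeriv b X Q Q' w w' Z) (hφ 0).aemeasurable
    hm.aestronglyMeasurable, (hφ 0).map_eq] at h0
  exact h0

/-- In the conjugated factor the direction enters as `-Yᴴ`. It equals `Y` for skew-adjoint `Y`, and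
its conjugate-linearity compensates that of `conj`, so the total is complex-linear in `Y`. -/
theorem tracePairDeriv_add_I_smul (v : UnitaryFamily q) (b : ℕ × Fin d) (X Q Q' : BlockMatrix q)
    (w w' : UnitaryWord q) (Y Z : BlockMatrix q) :
    v.tracePairDeriv b X Q Q' w w' (Y + Complex.I • Z) =
      v.tracePairDeriv b X Q Q' w w' Y + Complex.I * v.tracePairDeriv b X Q Q' w w' Z := by
  have h : -(Y + Complex.I • Z)ᴴ = -Yᴴ + (-Complex.I) • (-Zᴴ) := by
    rw [Matrix.conjTranspose_add, Matrix.conjTranspose_smul]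
    simp
    abel
  unfold tracePairDeriv
  rw [h, evalDeriv_add, evalDeriv_add, evalDeriv_smul, evalDeriv_smul]
  simp only [mul_add, add_mul, Matrix.trace_add, Matrix.mul_smul, Matrix.smul_mul,
    Matrix.trace_smul, map_add, smul_eq_mul, map_mul, map_neg, Complex.conj_I]
  ring

theorem integral_tracePairDeriv {μ : Measure (UnitaryFamily q)} [IsFiniteMeasure μ]
    (hμ : IsTranslationInvariant μ) (b : ℕ × Fin d) (X Q Q' : BlockMatrix q)
    (w w' : UnitaryWord q) (Y : Matrix (Fin (q b.2)) (Fin (q b.2)) ℂ) :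
    ∫ v, v.tracePairDeriv b X Q Q' w w' (blockExtend q b.2 b.2 Y) ∂μ = 0 := by
  -- Cartesian decomposition `Y = A + iB` with both parts skew-adjoint; it makes matrix units
  -- admissible directions.
  let A : skewAdjoint (Matrix (Fin (q b.2)) (Fin (q b.2)) ℂ) :=
    ⟨(1 / 2 : ℂ) • (Y - star Y), by
      rw [skewAdjoint.mem_iff, star_smul, star_sub, star_star, ← smul_neg, neg_sub]
      simp⟩
  let B : skewAdjoint (Matrix (Fin (q b.2)) (Fin (q b.2)) ℂ) :=
    ⟨(-Complex.I / 2) • (Y + star Y), by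
      rw [skewAdjoint.mem_iff, star_smul, star_add, star_star, ← neg_smul, add_comm]
      congr 1
      simp [neg_div]⟩
  have hY : blockExtend q b.2 b.2 Y =
      blockExtend q b.2 b.2 A + Complex.I • blockExtend q b.2 b.2 B := by
    have h : Y = (A : Matrix (Fin (q b.2)) (Fin (q b.2)) ℂ) + Complex.I • B.1 := by
      have : Complex.I * (-Complex.I / 2) = 1 / 2 := by
        rw [mul_div_assoc', mul_neg, Complex.I_mul_I, neg_neg]
      simp only [A, B, smul_smul, this, ← smul_add, sub_add_add_cancel]
      rw [← two_smul ℂ Y, smul_smul]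
      norm_num
    conv_lhs => rw [h]
    ext x y
    simp only [blockExtend, Matrix.of_apply, Matrix.add_apply, Matrix.smul_apply]
    split_ifs <;> simp
  simp only [hY, tracePairDeriv_add_I_smul]
  rw [integral_add ((isBoundedMeasurable_tracePairDeriv _ _ _ _ _ _ _).integrable μ)
    (((isBoundedMeasurable_tracePairDeriv _ _ _ _ _ _ _).integrable μ).const_mul _),
    integral_const_mul, integral_tracePairDeriv_of_skewAdjoint hμ,
    integral_tracePairDeriv_of_skewAdjoint hμ]
  simp

end UnitaryFamily
end SchwingerDyson

/-! ### The loop equation -/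

section LoopEquation

variable {d : ℕ} {q : Fin d → ℕ}

theorem norm_trace_mul_blockProj_mul_le (j : Fin d) (A B : BlockMatrix q) :
    ‖(A * (blockProj q j * B)).trace‖ ≤ q j * (‖B‖ * ‖A‖) := by
  rw [Matrix.trace_mul_comm, Matrix.mul_assoc]
  exact (norm_trace_blockProj_mul_le j _).trans
    (mul_le_mul_of_nonneg_left (norm_mul_le _ _) (Nat.cast_nonneg _))

namespace UnitaryFamily

/-- The first of the two traces into which the trace of a word splits at the letter `(b, ε)`
preceded by `S`. -/
noncomputable def prefixTrace (v : UnitaryFamily q) (b : ℕ × Fin d) (ε : Bool)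
    (S : BlockMatrix q) : ℂ :=
  if ε then (blockProj q b.2 * S).trace else -(blockProj q b.2 * (S * v.letter b ε)).trace

/-- The second of the two traces into which the trace of a word splits at the letter `(b, ε)`
followed by `S`. -/
noncomputable def suffixTrace (v : UnitaryFamily q) (b : ℕ × Fin d) (ε : Bool)
    (S : BlockMatrix q) : ℂ :=
  if ε then (blockProj q b.2 * (v.letter b ε * S)).trace else (blockProj q b.2 * S).trace

/-- The sum over the occurrences of `v b` and its adjoint in `w` of the products of traces into
which the trace of `S w Z` splits there. -/
noncomputable def splitSum (v : UnitaryFamily q) (b : ℕ × Fin d) (Z : BlockMatrix q) :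
    BlockMatrix q → UnitaryWord q → ℂ
  | _, [] => 0
  | S, x :: w =>
    (if x.1 = b then v.prefixTrace b x.2.1 S * v.suffixTrace b x.2.1 (x.2.2 * v.eval w * Z)
      else 0) + v.splitSum b Z (S * v.letter x.1 x.2.1 * x.2.2) w

theorem sum_trace_blockUnit_mul_evalDeriv (v : UnitaryFamily q) (b : ℕ × Fin d)
    (Z S : BlockMatrix q) (w : UnitaryWord q) :
    ∑ i, ∑ j, (blockUnit q b.2 i j * (S * v.evalDeriv b (blockUnit q b.2 j i) w * Z)).trace =
      v.splitSum b Z S w := by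
  induction w generalizing S with
  | nil => simp [evalDeriv, splitSum]
  | cons x w ih =>
    rw [splitSum, ← ih]
    simp only [evalDeriv, mul_add, add_mul, Matrix.trace_add, Finset.sum_add_distrib]
    refine congrArg₂ (· + ·) ?_ ?_
    · unfold letterDeriv prefixTrace suffixTrace
      split_ifs with h1 h2
      · subst h1
        rw [← sum_trace_blockUnit_mul_blockUnit_mul]
        simp only [letter, h2, if_true, Matrix.mul_assoc]
      · subst h1
        rw [neg_mul, ← sum_trace_blockUnit_mul_blockUnit_mul, ← Finset.sum_neg_distrib]
        refine Finset.sum_congr rfl fun i _ => ?_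
        rw [← Finset.sum_neg_distrib]
        refine Finset.sum_congr rfl fun j _ => ?_
        simp only [letter, if_neg h2, Matrix.mul_assoc, neg_mul, mul_neg, Matrix.trace_neg]
      · simp
    · simp only [Matrix.mul_assoc]

/-- Each letter of the word contributes at most one Hilbert–Schmidt inner product, once cyclicity
has moved the matrix unit to the front. The size of the block of `b` does not enter the bound. -/
theorem norm_sum_trace_blockUnit_mul_conj_evalDeriv_le (v : UnitaryFamily q) (b : ℕ × Fin d)
    (A Z S : BlockMatrix q) (w : UnitaryWord q) {C α : ℝ} (hC : 0 ≤ C)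
    (hw : ∀ x ∈ w, ‖x.2.2‖ ≤ C) (hα : ∀ M : BlockMatrix q, ‖(A * M).trace‖ ≤ α * ‖M‖)
    (hα0 : 0 ≤ α) :
    ‖∑ i, ∑ j, (blockUnit q b.2 i j * A).trace *
      conj (S * v.evalDeriv b (blockUnit q b.2 i j) w * Z).trace‖ ≤
      w.length * (α * (‖S‖ * ‖Z‖ * C ^ w.length)) := by
  induction w generalizing S with
  | nil => simp [evalDeriv]
  | cons x w ih =>
    rw [List.forall_mem_cons] at hw
    simp only [evalDeriv, mul_add, add_mul, Matrix.trace_add, Finset.sum_add_distrib, map_add]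
    have hS : ‖S * v.letter x.1 x.2.1 * x.2.2‖ ≤ ‖S‖ * C := by
      rw [Matrix.mul_assoc]
      exact (norm_mul_le _ _).trans (mul_le_mul_of_nonneg_left (v.norm_letter_mul_le _ _ hw.1)
        (norm_nonneg _))
    have hE := v.norm_eval_le w hC hw.2
    have h2 := ih (S * v.letter x.1 x.2.1 * x.2.2) hw.2
    have h2' : ‖∑ i, ∑ j, (blockUnit q b.2 i j * A).trace *
        conj (S * (v.letter x.1 x.2.1 * x.2.2 * v.evalDeriv b (blockUnit q b.2 i j) w) * Z).trace‖ ≤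
        w.length * (α * (‖S‖ * C * ‖Z‖ * C ^ w.length)) := by
      simp only [← Matrix.mul_assoc] at h2 ⊢
      refine h2.trans ?_
      gcongr
    have h1 : ‖∑ i, ∑ j, (blockUnit q b.2 i j * A).trace *
        conj (S * (v.letterDeriv b (blockUnit q b.2 i j) x.1 x.2.1 * x.2.2 * v.eval w) * Z).trace‖ ≤
        α * (‖S‖ * C * ‖Z‖ * C ^ w.length) := by
      have hD : ‖x.2.2 * v.eval w * Z * S‖ ≤ ‖S‖ * C * ‖Z‖ * C ^ w.length := by
        calc _ ≤ C * C ^ w.length * ‖Z‖ * ‖S‖ := by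
              refine (norm_mul_le _ _).trans (mul_le_mul_of_nonneg_right ((norm_mul_le _ _).trans
                (mul_le_mul_of_nonneg_right ((norm_mul_le _ _).trans (mul_le_mul hw.1 hE
                (norm_nonneg _) hC)) (norm_nonneg _))) (norm_nonneg _))
          _ = _ := by ring
      have hV := v.norm_letter_le x.1 x.2.1
      unfold letterDeriv
      split_ifs with h1 h2
      · have e : ∀ i j, (S * (blockUnit q b.2 i j * (v x.1).toMatrix * x.2.2 * v.eval w) * Z).trace
            = (blockUnit q b.2 i j * (v.letter x.1 x.2.1 * (x.2.2 * v.eval w * Z * S))).trace := by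
          intro i j
          rw [Matrix.mul_assoc, Matrix.trace_mul_comm]
          simp only [letter, h2, if_true, Matrix.mul_assoc]
        simp only [e]
        refine (norm_sum_trace_blockUnit_mul_conj_le b.2 _ _ hα hα0).trans
          (mul_le_mul_of_nonneg_left (le_trans ?_ hD) hα0)
        exact (norm_mul_le _ _).trans (mul_le_of_le_one_left (norm_nonneg _) hV)
      · have e : ∀ i j,
            (S * (-((v x.1).toMatrixᴴ * blockUnit q b.2 i j) * x.2.2 * v.eval w) * Z).trace
            = (blockUnit q b.2 i j * -((x.2.2 * v.eval w * Z * S) * v.letter x.1 x.2.1)).trace := by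
          intro i j
          have := Matrix.trace_mul_comm (S * (v x.1).toMatrixᴴ)
            (blockUnit q b.2 i j * x.2.2 * v.eval w * Z)
          simp only [neg_mul, mul_neg, Matrix.trace_neg, letter, h2, Matrix.mul_assoc] at this ⊢
          rw [this]
          rfl
        simp only [e]
        refine (norm_sum_trace_blockUnit_mul_conj_le b.2 _ _ hα hα0).trans
          (mul_le_mul_of_nonneg_left (le_trans ?_ hD) hα0)
        rw [norm_neg]
        exact (norm_mul_le _ _).trans (mul_le_of_le_one_right (norm_nonneg _) hV)
      · simp only [zero_mul, mul_zero, Matrix.trace_zero, map_zero, Finset.sum_const_zero, norm_zero]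
        positivity
    refine (norm_add_le _ _).trans ((add_le_add h1 h2').trans (le_of_eq ?_))
    push_cast [List.length_cons]
    ring

/-- What precedes the rest of the word in the loop equation of a word starting with `(b, ε, D)`. -/
noncomputable def loopPrefix (v : UnitaryFamily q) (b : ℕ × Fin d) (ε : Bool)
    (D : BlockMatrix q) : BlockMatrix q :=
  if ε then v.letter b ε * D else D

/-- What follows the rest of the word in the loop equation of a word starting with `(b, ε, D)`. -/
noncomputable def loopSuffix (v : UnitaryFamily q) (b : ℕ × Fin d) (ε : Bool)
    (B : BlockMatrix q) : BlockMatrix q :=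
  if ε then B else B * v.letter b ε

/-- The loop equation: up to a term coming from the derivative of the conjugated trace, the trace
of a word reduces to products of traces of shorter words. -/
theorem exists_loopEquation {μ : Measure (UnitaryFamily q)} [IsFiniteMeasure μ]
    (hμ : IsTranslationInvariant μ) (b : ℕ × Fin d) (ε : Bool) (D : BlockMatrix q)
    (w : UnitaryWord q) (j : Fin d) (B : BlockMatrix q) {C : ℝ} (hC : 1 ≤ C)
    (hw : ∀ x ∈ (b, ε, D) :: w, ‖x.2.2‖ ≤ C) (hB : ‖B‖ ≤ C) :
    ∃ H : UnitaryFamily q → ℂ,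
      (∀ v, ‖H v‖ ≤ ((b, ε, D) :: w).length * (q j * (C * C ^ ((b, ε, D) :: w).length) *
        (C * C ^ ((b, ε, D) :: w).length))) ∧
      (∀ f : UnitaryFamily q → ℂ, (∀ v, f v =
        (if ε then (1 : ℂ) else -1) * (q b.2 * (v.eval ((b, ε, D) :: w) * (blockProj q j * B)).trace *
          conj (v.eval ((b, ε, D) :: w) * (blockProj q j * B)).trace) +
        v.splitSum b (blockProj q j * v.loopSuffix b ε B) (v.loopPrefix b ε D) w *
          conj (v.eval ((b, ε, D) :: w) * (blockProj q j * B)).trace - H v) →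
        Integrable f μ ∧ ∫ v, f v ∂μ = 0) := by
  have hC0 : (0 : ℝ) ≤ C := zero_le_one.trans hC
  set W : UnitaryWord q := (b, ε, D) :: w with hW
  set Q : BlockMatrix q := blockProj q j * B with hQ
  -- The word cut cyclically where the matrix unit is inserted: before the first letter if it is
  -- unitary, just after it if it is an adjoint. There the derivative, `Y v` or `-v* Y`, places its
  -- own unit next to the cut.
  let A : UnitaryFamily q → BlockMatrix q := fun v =>
    if ε then v.eval W * Q else D * v.eval w * Q * v.letter b ε
  have hQn : ‖Q‖ ≤ C := (norm_mul_le _ _).trans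
    ((mul_le_of_le_one_left (norm_nonneg _) (norm_blockProj_le j)).trans hB)
  have hWn : ∀ v : UnitaryFamily q, ‖v.eval W‖ ≤ C ^ W.length := fun v => v.norm_eval_le W hC0 hw
  have hA : ∀ (v : UnitaryFamily q) (M : BlockMatrix q),
      ‖(A v * M).trace‖ ≤ q j * (C * C ^ W.length) * ‖M‖ := by
    intro v M
    -- The projector inside `Q` restricts the trace to `q j` diagonal entries, hence the factor `q
    -- j` and not the full dimension.
    have key : ∀ E M' : BlockMatrix q, ‖E‖ ≤ C ^ W.length → ‖M'‖ ≤ ‖M‖ →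
        ‖(E * Q * M').trace‖ ≤ q j * (C * C ^ W.length) * ‖M‖ := by
      intro E M' hE hM'
      rw [hQ, Matrix.mul_assoc, Matrix.mul_assoc]
      refine (norm_trace_mul_blockProj_mul_le j _ _).trans ?_
      rw [mul_assoc]
      refine mul_le_mul_of_nonneg_left ?_ (Nat.cast_nonneg _)
      calc ‖B * M'‖ * ‖E‖ ≤ (C * ‖M‖) * C ^ W.length := by
            refine mul_le_mul ((norm_mul_le _ _).trans ?_) hE (norm_nonneg _) (by positivity)
            exact mul_le_mul hB hM' (norm_nonneg _) hC0
        _ = _ := by ring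
    simp only [A]
    split_ifs with h
    · exact key _ _ (hWn v) le_rfl
    · rw [Matrix.mul_assoc]
      refine key _ _ ?_ ((norm_mul_le _ _).trans
        (mul_le_of_le_one_left (norm_nonneg _) (v.norm_letter_le _ _)))
      rw [List.forall_mem_cons] at hw
      rw [hW, List.length_cons, pow_succ']
      exact (norm_mul_le _ _).trans (mul_le_mul hw.1 (v.norm_eval_le w hC0 hw.2)
        (norm_nonneg _) hC0)
  refine ⟨fun v => ∑ i, ∑ l, (blockUnit q b.2 i l * A v).trace *
      conj (1 * v.evalDeriv b (blockUnit q b.2 i l) W * Q).trace, fun v => ?_, fun f hf => ?_⟩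
  · refine (v.norm_sum_trace_blockUnit_mul_conj_evalDeriv_le b (A v) Q 1 W hC0 hw (hA v)
      (by positivity)).trans ?_
    gcongr
    exact (mul_le_mul norm_one_le hQn (norm_nonneg _) zero_le_one).trans (by rw [one_mul])
  -- The insertion point of `A`, expressed through the outer factor `X` or the first deterministic
  -- matrix of the word, so that integration by parts applies.
  · let X : Fin (q b.2) → Fin (q b.2) → BlockMatrix q := fun i l =>
      if ε then blockUnit q b.2 i l else 1
    let U : Fin (q b.2) → Fin (q b.2) → UnitaryWord q := fun i l =>
      if ε then W else (b, ε, blockUnit q b.2 i l * D) :: w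
    have hX : ∀ (v : UnitaryFamily q) i l, (X i l * v.eval (U i l) * Q).trace =
        (blockUnit q b.2 i l * A v).trace := by
      intro v i l
      cases hε : ε
      · simp only [X, U, A, hε, Bool.false_eq_true, if_false, eval, Matrix.one_mul]
        simp only [Matrix.mul_assoc]
        rw [Matrix.trace_mul_comm]
        simp only [Matrix.mul_assoc]
      · simp only [X, U, A, hε, if_true, Matrix.mul_assoc]
    have hE : ∀ v : UnitaryFamily q,
        ∑ i, ∑ l, (X i l * v.evalDeriv b (blockUnit q b.2 l i) (U i l) * Q).trace =
        (if ε then (1 : ℂ) else -1) * (q b.2 * (v.eval W * Q).trace) +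
          v.splitSum b (blockProj q j * v.loopSuffix b ε B) (v.loopPrefix b ε D) w := by
      intro v
      cases hε : ε
      · simp only [X, U, hε, Bool.false_eq_true, if_false, evalDeriv, Matrix.one_mul,
          add_mul, Matrix.trace_add, Finset.sum_add_distrib]
        refine congrArg₂ (· + ·) ?_ ?_
        · have e : ∀ i l, (v.letterDeriv b (blockUnit q b.2 l i) b false *
              (blockUnit q b.2 i l * D) * v.eval w * Q).trace =
              -((v.letter b false * (blockUnit q b.2 l i * blockUnit q b.2 i l)) *
                (D * v.eval w * Q)).trace := by
            intro i l
            simp [letterDeriv, letter, Matrix.mul_assoc]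
          simp only [e, Finset.sum_neg_distrib, ← Matrix.trace_sum, ← Finset.sum_mul,
            ← Finset.mul_sum]
          rw [sum_blockUnit_mul_blockUnit, Matrix.mul_smul, letter_mul_blockProj]
          simp [hW, hε, eval, Matrix.mul_assoc]
        · rw [← sum_trace_blockUnit_mul_evalDeriv]
          refine Finset.sum_congr rfl fun i _ => Finset.sum_congr rfl fun l _ => ?_
          simp only [loopPrefix, loopSuffix, Bool.false_eq_true, if_false, Matrix.mul_assoc, hQ]
          rw [Matrix.trace_mul_comm]
          simp only [Matrix.mul_assoc]
      -- For a unitary first letter the leading term is itself a split term: its prefix is empty,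
      -- and `tr p_b = q_b`.
      · have h := v.sum_trace_blockUnit_mul_evalDeriv b Q 1 ((b, true, D) :: w)
        simp only [Matrix.one_mul, ← Matrix.mul_assoc] at h
        simp only [X, U, hε, if_true, hW, h, splitSum, prefixTrace, suffixTrace, loopPrefix,
          loopSuffix, Matrix.mul_one, trace_blockProj, one_mul, eval]
        simp only [← Matrix.mul_assoc, blockProj_mul_letter, ← hQ]
    have hneg : ∀ (v : UnitaryFamily q) i l,
        conj (1 * v.evalDeriv b (-blockUnit q b.2 i l) W * Q).trace =
        -conj (1 * v.evalDeriv b (blockUnit q b.2 i l) W * Q).trace := by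
      intro v i l
      have : -blockUnit q b.2 i l = (-1 : ℂ) • blockUnit q b.2 i l := by simp
      rw [this, evalDeriv_smul]
      simp
    have hsum : f = fun v => ∑ i, ∑ l,
        v.tracePairDeriv b (X i l) Q Q (U i l) W (blockUnit q b.2 l i) := by
      funext v
      rw [hf]
      simp only [tracePairDeriv, Finset.sum_add_distrib, ← Finset.sum_mul,
        blockUnit_conjTranspose, hX, hE, hneg, mul_neg, Finset.sum_neg_distrib]
      rw [Matrix.one_mul]
      ring
    rw [hsum]
    have hint : ∀ i l, Integrable (fun v : UnitaryFamily q =>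
        v.tracePairDeriv b (X i l) Q Q (U i l) W (blockUnit q b.2 l i)) μ := fun i l =>
      (isBoundedMeasurable_tracePairDeriv _ _ _ _ _ _ _).integrable μ
    refine ⟨integrable_finsetSum _ fun i _ => integrable_finsetSum _ fun l _ => hint i l, ?_⟩
    rw [integral_finsetSum _ fun i _ => integrable_finsetSum _ fun l _ => hint i l]
    refine Finset.sum_eq_zero fun i _ => ?_
    rw [integral_finsetSum _ fun l _ => hint i l]
    refine Finset.sum_eq_zero fun l _ => ?_
    rw [blockUnit_eq_blockExtend]
    exact integral_tracePairDeriv hμ _ _ _ _ _ _ _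

end UnitaryFamily
end LoopEquation

/-! ### Second-moment estimate and convergence in `L¹` -/

section Negligible

/-- Isolate the quadratic term, whose integral has modulus `E |x|²` since `σ` is a phase, and bound
the remaining factor `conj x` by `K`. -/
theorem lintegral_enorm_sq_le_of_integral_eq_zero {α : Type*} [MeasurableSpace α]
    {μ : Measure α} [IsProbabilityMeasure μ] {x y h : α → ℂ} (hx : IsBoundedMeasurable x)
    {K K' : ℝ} (hxK : ∀ a, ‖x a‖ ≤ K) (hh : ∀ a, ‖h a‖ ≤ K') {σ : ℂ} (hσ : ‖σ‖ = 1)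
    (hint : Integrable (fun a => σ * (x a * conj (x a)) + y a * conj (x a) - h a) μ)
    (hzero : ∫ a, (σ * (x a * conj (x a)) + y a * conj (x a) - h a) ∂μ = 0) :
    ∫⁻ a, ‖x a‖ₑ ^ 2 ∂μ ≤ ENNReal.ofReal K * ∫⁻ a, ‖y a‖ₑ ∂μ + ENNReal.ofReal K' := by
  have hxx : Integrable (fun a => σ * (x a * conj (x a))) μ :=
    ((hx.mul hx.comp_conj).integrable μ).const_mul σ
  have h1 : ∫⁻ a, ‖x a‖ₑ ^ 2 ∂μ = ‖∫ a, σ * (x a * conj (x a)) ∂μ‖ₑ := by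
    have hsq : ∀ a, x a * conj (x a) = ((‖x a‖ ^ 2 : ℝ) : ℂ) := fun a => by
      rw [Complex.mul_conj, Complex.normSq_eq_norm_sq]
    have hi : Integrable (fun a => ‖x a‖ ^ 2) μ := by
      have := ((hx.mul hx.comp_conj).integrable μ).norm
      refine this.congr (ae_of_all _ fun a => ?_)
      simp [sq]
    rw [integral_const_mul, enorm_mul, ← ofReal_norm σ, hσ, ENNReal.ofReal_one, one_mul]
    simp only [hsq]
    rw [integral_complex_ofReal, ← ofReal_norm, Complex.norm_real, Real.norm_eq_abs,
      abs_of_nonneg (integral_nonneg fun a => by positivity),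
      ofReal_integral_eq_lintegral_ofReal hi (ae_of_all _ fun a => by positivity)]
    refine lintegral_congr fun a => ?_
    rw [← ofReal_norm, ENNReal.ofReal_pow (norm_nonneg _)]
  have h2 : ∫ a, σ * (x a * conj (x a)) ∂μ = -∫ a, (y a * conj (x a) - h a) ∂μ := by
    have hr : Integrable (fun a => y a * conj (x a) - h a) μ := by
      refine (hint.sub hxx).congr (ae_of_all _ fun a => ?_)
      simp only [Pi.sub_apply]; ring
    rw [eq_neg_iff_add_eq_zero, ← integral_add hxx hr, ← hzero]
    refine integral_congr_ae (ae_of_all _ fun a => ?_)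
    ring
  rw [h1, h2, enorm_neg]
  calc _ ≤ ∫⁻ a, ‖y a * conj (x a) - h a‖ₑ ∂μ := enorm_integral_le_lintegral_enorm _
    _ ≤ ∫⁻ a, (ENNReal.ofReal K * ‖y a‖ₑ + ENNReal.ofReal K') ∂μ := by
        refine lintegral_mono fun a => (enorm_sub_le).trans (add_le_add ?_ ?_)
        · rw [enorm_mul, mul_comm, ← ofReal_norm (conj (x a)), RCLike.norm_conj]
          gcongr
          exact hxK a
        · rw [← ofReal_norm]
          exact ENNReal.ofReal_le_ofReal (hh a)
    _ = _ := by
        -- The constant is the measurable summand, so `y` needs no measurability of its own.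
        rw [lintegral_add_right _ measurable_const, lintegral_const_mul' _ _ ENNReal.ofReal_ne_top]
        simp

theorem lintegral_enorm_le_rpow_lintegral_enorm_sq {α : Type*} [MeasurableSpace α]
    {μ : Measure α} [IsProbabilityMeasure μ] {x : α → ℂ} (hx : StronglyMeasurable x) :
    ∫⁻ a, ‖x a‖ₑ ∂μ ≤ (∫⁻ a, ‖x a‖ₑ ^ 2 ∂μ) ^ (1 / 2 : ℝ) := by
  have h := eLpNorm_le_eLpNorm_of_exponent_le (μ := μ) (p := 1) (q := 2) (by norm_num)
    hx.aestronglyMeasurable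
  rw [eLpNorm_one_eq_lintegral_enorm, eLpNorm_eq_lintegral_rpow_enorm_toReal (by norm_num) (by norm_num)] at h
  simpa using h

variable {d : ℕ} {q : ℕ → Fin d → ℕ}

/-- Convergence to zero in `L¹` of functions of families of unitary matrices. -/
def IsNegligible (μ : ∀ n, Measure (UnitaryFamily (q n))) (X : ∀ n, UnitaryFamily (q n) → ℂ) :
    Prop :=
  Tendsto (fun n => ∫⁻ v, ‖X n v‖ₑ ∂μ n) atTop (𝓝 0)

variable {μ : ∀ n, Measure (UnitaryFamily (q n))}

theorem IsNegligible.of_le {X Y : ∀ n, UnitaryFamily (q n) → ℂ} (hX : IsNegligible μ X)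
    (h : ∀ n v, ‖Y n v‖ ≤ ‖X n v‖) : IsNegligible μ Y := by
  refine tendsto_of_tendsto_of_tendsto_of_le_of_le tendsto_const_nhds hX (fun n => zero_le)
    fun n => lintegral_mono fun v => ?_
  rw [← ofReal_norm, ← ofReal_norm]
  exact ENNReal.ofReal_le_ofReal (h n v)

theorem IsNegligible.of_le_add {X Y Z : ∀ n, UnitaryFamily (q n) → ℂ} (hX : IsNegligible μ X)
    (hXm : ∀ n, StronglyMeasurable (X n)) (hY : IsNegligible μ Y) {K : ℝ} (hK : 0 ≤ K)
    (h : ∀ n v, ‖Z n v‖ ≤ K * ‖X n v‖ + ‖Y n v‖) : IsNegligible μ Z := by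
  have hlim : Tendsto (fun n => ENNReal.ofReal K * ∫⁻ v, ‖X n v‖ₑ ∂μ n + ∫⁻ v, ‖Y n v‖ₑ ∂μ n)
      atTop (𝓝 0) := by
    have h1 := ENNReal.Tendsto.const_mul (a := ENNReal.ofReal K) hX
      (Or.inr ENNReal.ofReal_ne_top)
    simpa using h1.add hY
  refine tendsto_of_tendsto_of_tendsto_of_le_of_le tendsto_const_nhds hlim (fun n => zero_le)
    fun n => ?_
  change _ ≤ ENNReal.ofReal K * _ + _
  rw [← lintegral_const_mul' _ _ ENNReal.ofReal_ne_top,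
    ← lintegral_add_left ((hXm n).enorm.const_mul _)]
  refine lintegral_mono fun v => ?_
  rw [← ofReal_norm, ← ofReal_norm, ← ofReal_norm,
    ← ENNReal.ofReal_mul hK, ← ENNReal.ofReal_add (by positivity) (norm_nonneg _)]
  exact ENNReal.ofReal_le_ofReal (h n v)

theorem isNegligible_const [∀ n, IsProbabilityMeasure (μ n)] {c : ℕ → ℂ}
    (hc : Tendsto c atTop (𝓝 0)) : IsNegligible μ fun n _ => c n := by
  simpa [IsNegligible] using hc.enorm

end Negligible

/-! ### Induction on reduced words -/

section WordSequences

variable {d : ℕ} {q : ℕ → Fin d → ℕ}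

/-- Words whose deterministic matrices are sequences of matrices. -/
abbrev WordSeq (q : ℕ → Fin d → ℕ) : Type :=
  List ((ℕ × Fin d) × Bool × ((n : ℕ) → BlockMatrix (q n)))

namespace WordSeq

/-- The `n`-th word of a sequence of words. -/
def level (w : WordSeq q) (n : ℕ) : UnitaryWord (q n) :=
  w.map fun x => (x.1, x.2.1, x.2.2 n)

/-- All the matrices of the word have norm at most `C`. -/
def IsBounded (C : ℝ) (w : WordSeq q) : Prop := ∀ x ∈ w, ∀ n, ‖x.2.2 n‖ ≤ C

/-- Between two consecutive occurrences of a letter with opposite exponents, the deterministic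
matrix is asymptotically centered. -/
def IsReduced (w : WordSeq q) : Prop :=
  w.IsChain fun x y => x.1 = y.1 → x.2.1 ≠ y.2.1 →
    Tendsto (fun n => condE (q n) (x.2.2 n) x.1.2) atTop (𝓝 0)

theorem IsBounded.norm_level_le {C : ℝ} {w : WordSeq q} (hw : w.IsBounded C) (n : ℕ) :
    ∀ x ∈ w.level n, ‖x.2.2‖ ≤ C := by
  simp only [level, List.mem_map]
  rintro _ ⟨x, hx, rfl⟩
  exact hw x hx n

end WordSeq

namespace UnitaryFamily

variable {μ : ∀ n, Measure (UnitaryFamily (q n))}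

theorem norm_suffixTrace_le {q : Fin d → ℕ} (v : UnitaryFamily q) (b : ℕ × Fin d) (ε : Bool)
    (S : BlockMatrix q) (j : Fin d) (B : BlockMatrix q) :
    ‖v.suffixTrace b ε (S * (blockProj q j * B))‖ ≤ q j * (‖B‖ * ‖S‖) := by
  have hp := norm_blockProj_le (q := q) b.2
  have key : ∀ A : BlockMatrix q, ‖A‖ ≤ ‖S‖ → ‖(blockProj q b.2 * A * (blockProj q j * B)).trace‖ ≤
      q j * (‖B‖ * ‖S‖) := by
    intro A hA
    refine (norm_trace_mul_blockProj_mul_le j _ _).trans ?_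
    gcongr
    exact (norm_mul_le _ _).trans ((mul_le_of_le_one_left (norm_nonneg _) hp).trans hA)
  unfold suffixTrace
  split_ifs
  · rw [← Matrix.mul_assoc (v.letter b ε), ← Matrix.mul_assoc (blockProj q b.2)]
    exact key _ ((norm_mul_le _ _).trans
      (mul_le_of_le_one_left (norm_nonneg _) (v.norm_letter_le _ _)))
  · rw [← Matrix.mul_assoc (blockProj q b.2)]
    exact key _ le_rfl

theorem stronglyMeasurable_prefixTrace {q : Fin d → ℕ} (b : ℕ × Fin d) (ε : Bool)
    {S : UnitaryFamily q → BlockMatrix q} (hS : StronglyMeasurable S) :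
    StronglyMeasurable fun v : UnitaryFamily q => v.prefixTrace b ε (S v) := by
  unfold prefixTrace
  cases ε
  · simpa [Pi.neg_def] using
      (((hS.mul (stronglyMeasurable_letter b false)).const_mul (blockProj q b.2)).matrix_trace).neg
  · simpa using (hS.const_mul (blockProj q b.2)).matrix_trace

/-- Each split term is a negligible prefix trace times a bounded suffix trace. `B` may be random
because, for an adjoint first letter, the loop equation moves that letter into the suffix. -/
theorem isNegligible_splitSum (b : ℕ × Fin d) (j : Fin d)
    (B : ∀ n, UnitaryFamily (q n) → BlockMatrix (q n)) {C : ℝ} (hC : 0 ≤ C)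
    (hB : ∀ n v, ‖B n v‖ ≤ C) (w : WordSeq q) (hw : w.IsBounded C)
    (S : ∀ n, UnitaryFamily (q n) → BlockMatrix (q n)) (hS : ∀ n, StronglyMeasurable (S n))
    (hpre : ∀ (pre : WordSeq q) x post, w = pre ++ x :: post → x.1 = b →
      IsNegligible μ fun n v => v.prefixTrace b x.2.1 (S n v * v.eval (pre.level n)) / q n b.2) :
    IsNegligible μ fun n v =>
      v.splitSum b (blockProj (q n) j * B n v) (S n v) (WordSeq.level w n) / (q n b.2 * q n j) := by
  induction w generalizing S with
  | nil => simp [IsNegligible, WordSeq.level, splitSum]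
  | cons x w ih =>
    have hw' := List.forall_mem_cons.1 hw
    have h2 := ih hw'.2 (fun n v => S n v * v.letter x.1 x.2.1 * x.2.2 n)
      (fun n => ((hS n).mul (stronglyMeasurable_letter _ _)).mul_const _) (by
        intro pre y post h hy
        have := hpre (x :: pre) y post (by rw [h]; rfl) hy
        simpa only [WordSeq.level, List.map_cons, eval, Matrix.mul_assoc] using this)
    by_cases hx : x.1 = b
    · have h1 := hpre [] x w rfl hx
      have hm : ∀ n, StronglyMeasurable fun v : UnitaryFamily (q n) =>
          v.prefixTrace b x.2.1 (S n v * v.eval (WordSeq.level [] n)) / q n b.2 := by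
        intro n
        simp only [div_eq_mul_inv]
        exact (stronglyMeasurable_prefixTrace b _
          ((hS n).mul (stronglyMeasurable_eval _))).mul_const _
      refine h1.of_le_add hm h2 (K := C * (C * C ^ w.length)) (by positivity) fun n v => ?_
      have hs : ‖v.suffixTrace b x.2.1
          (x.2.2 n * v.eval (WordSeq.level w n) * (blockProj (q n) j * B n v)) / q n j‖ ≤
          C * (C * C ^ w.length) := by
        rw [norm_div, Complex.norm_natCast]
        refine div_le_of_le_mul₀ (Nat.cast_nonneg _) (by positivity) ?_
        refine (v.norm_suffixTrace_le _ _ _ _ _).trans ?_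
        rw [mul_comm]
        gcongr
        · exact hB n v
        · refine (norm_mul_le _ _).trans (mul_le_mul (hw'.1 n) ?_ (norm_nonneg _) hC)
          have := v.norm_eval_le (WordSeq.level w n) hC (WordSeq.IsBounded.norm_level_le hw'.2 n)
          simpa [WordSeq.level] using this
      have hsplit : v.splitSum b (blockProj (q n) j * B n v) (S n v) (WordSeq.level (x :: w) n) =
          v.prefixTrace b x.2.1 (S n v * v.eval (WordSeq.level [] n)) * v.suffixTrace b x.2.1
          (x.2.2 n * v.eval (WordSeq.level w n) * (blockProj (q n) j * B n v)) +
          v.splitSum b (blockProj (q n) j * B n v) (S n v * v.letter x.1 x.2.1 * x.2.2 n)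
            (WordSeq.level w n) := by
        simp [WordSeq.level, splitSum, hx, eval]
      rw [hsplit, add_div, mul_div_mul_comm]
      refine (norm_add_le _ _).trans (add_le_add ?_ le_rfl)
      rw [norm_mul, mul_comm]
      exact mul_le_mul_of_nonneg_right hs (norm_nonneg _)
    · refine h2.of_le fun n v => le_of_eq ?_
      simp [WordSeq.level, splitSum, hx]

/-- With equal exponents the prefix keeps its first letter, and its trace is that of a genuine
shorter word closed by `p_b`. -/
theorem prefixTrace_loopPrefix_self {q : Fin d → ℕ} (v : UnitaryFamily q) (b : ℕ × Fin d)
    (ε : Bool) (D E : BlockMatrix q) :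
    ‖v.prefixTrace b ε (v.loopPrefix b ε D * E)‖ =
      ‖(v.letter b ε * D * E * (blockProj q b.2 * 1)).trace‖ := by
  rw [Matrix.mul_one, Matrix.trace_mul_comm]
  cases ε
  · simp only [prefixTrace, loopPrefix, Bool.false_eq_true, if_false, norm_neg]
    rw [← Matrix.mul_assoc, Matrix.trace_mul_comm]
    simp only [← Matrix.mul_assoc, letter_mul_blockProj, blockProj_mul_letter]
  · simp only [prefixTrace, loopPrefix, if_true]

/-- With opposite exponents the two letters cancel through `v* v = p_b`, and `D` becomes the matrix
that closes the inner word. -/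
theorem prefixTrace_loopPrefix_not {q : Fin d → ℕ} (v : UnitaryFamily q) (b : ℕ × Fin d)
    (ε ε' : Bool) (hε : ε ≠ ε') (D E : BlockMatrix q) :
    ‖v.prefixTrace b ε' (v.loopPrefix b ε D * E)‖ = ‖(E * (blockProj q b.2 * D)).trace‖ := by
  rw [Matrix.trace_mul_comm]
  cases ε <;> cases ε' <;> simp only [ne_eq, not_true_eq_false] at hε
  · simp [prefixTrace, loopPrefix, Matrix.mul_assoc]
  · simp only [prefixTrace, loopPrefix, Bool.false_eq_true, if_false, if_true, norm_neg]
    rw [← Matrix.mul_assoc, Matrix.trace_mul_comm]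
    simp only [← Matrix.mul_assoc, letter_mul_blockProj]
    simp only [letter, Bool.false_eq_true, if_false, if_true, BlockUnitary.conjTranspose_mul_self]

theorem norm_loopSuffix_le {q : Fin d → ℕ} (v : UnitaryFamily q) (b : ℕ × Fin d) (ε : Bool)
    (B : BlockMatrix q) : ‖v.loopSuffix b ε B‖ ≤ ‖B‖ := by
  unfold loopSuffix
  split_ifs
  · exact le_rfl
  · exact (norm_mul_le _ _).trans (mul_le_of_le_one_right (norm_nonneg _) (v.norm_letter_le _ _))

theorem stronglyMeasurable_loopPrefix {q : Fin d → ℕ} (b : ℕ × Fin d) (ε : Bool)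
    (D : BlockMatrix q) : StronglyMeasurable fun v : UnitaryFamily q => v.loopPrefix b ε D := by
  unfold loopPrefix
  split_ifs
  · exact (stronglyMeasurable_letter _ _).mul_const _
  · exact stronglyMeasurable_const

theorem lintegral_enorm_sq_trace_le {q : Fin d → ℕ} {μ : Measure (UnitaryFamily q)}
    [IsProbabilityMeasure μ] (hμ : IsTranslationInvariant μ) (b : ℕ × Fin d) (ε : Bool)
    (D : BlockMatrix q) (w : UnitaryWord q) (j : Fin d) (B : BlockMatrix q) {C : ℝ} (hC : 1 ≤ C)
    (hw : ∀ x ∈ (b, ε, D) :: w, ‖x.2.2‖ ≤ C) (hB : ‖B‖ ≤ C) (hb : q b.2 ≠ 0) (hj : q j ≠ 0) :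
    ∫⁻ v, ‖(v.eval ((b, ε, D) :: w) * (blockProj q j * B)).trace / q j‖ₑ ^ 2 ∂μ ≤
      ENNReal.ofReal (C * C ^ (w.length + 1)) * ∫⁻ v, ‖v.splitSum b
        (blockProj q j * v.loopSuffix b ε B) (v.loopPrefix b ε D) w / (q b.2 * q j)‖ₑ ∂μ +
      ENNReal.ofReal ((w.length + 1) * (C * C ^ (w.length + 1)) ^ 2 / (q b.2 * q j)) := by
  have hb' : (q b.2 : ℂ) ≠ 0 := Nat.cast_ne_zero.2 hb
  have hj' : (q j : ℂ) ≠ 0 := Nat.cast_ne_zero.2 hj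
  have hC0 : 0 ≤ C := zero_le_one.trans hC
  obtain ⟨H, hH, hf⟩ := exists_loopEquation hμ b ε D w j B hC hw hB
  obtain ⟨hint, hzero⟩ := hf _ fun v => rfl
  -- Normalization by `q_b q_j²`: one `q_j` for each of the two full traces, and `q_b q_j` for the
  -- pair of split traces.
  have hscale : ∀ v : UnitaryFamily q,
      (if ε then (1 : ℂ) else -1) *
        ((v.eval ((b, ε, D) :: w) * (blockProj q j * B)).trace / q j *
          conj ((v.eval ((b, ε, D) :: w) * (blockProj q j * B)).trace / q j)) +
      v.splitSum b (blockProj q j * v.loopSuffix b ε B) (v.loopPrefix b ε D) w / (q b.2 * q j) *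
          conj ((v.eval ((b, ε, D) :: w) * (blockProj q j * B)).trace / q j) -
      H v / (q b.2 * q j ^ 2) = ((q b.2 : ℂ) * q j ^ 2)⁻¹ *
      ((if ε then (1 : ℂ) else -1) * (q b.2 * (v.eval ((b, ε, D) :: w) * (blockProj q j * B)).trace *
          conj (v.eval ((b, ε, D) :: w) * (blockProj q j * B)).trace) +
        v.splitSum b (blockProj q j * v.loopSuffix b ε B) (v.loopPrefix b ε D) w *
          conj (v.eval ((b, ε, D) :: w) * (blockProj q j * B)).trace - H v) := by
    intro v
    rw [map_div₀, Complex.conj_natCast]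
    field_simp
  refine lintegral_enorm_sq_le_of_integral_eq_zero
    (σ := if ε then (1 : ℂ) else -1) (h := fun v => H v / (q b.2 * q j ^ 2)) ?_ ?_ ?_
    (by split_ifs <;> simp) ?_ ?_
  · have := (isBoundedMeasurable_trace_eval 1 (blockProj q j * B) ((b, ε, D) :: w)).mul
      (g := fun _ => (q j : ℂ)⁻¹) ⟨stronglyMeasurable_const, _, fun _ => le_rfl⟩
    simpa only [Matrix.one_mul, div_eq_mul_inv] using this
  · intro v
    rw [norm_div, Complex.norm_natCast]
    refine div_le_of_le_mul₀ (Nat.cast_nonneg _) (by positivity) ?_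
    refine (norm_trace_mul_blockProj_mul_le j _ _).trans ?_
    rw [mul_comm]
    gcongr
    exact v.norm_eval_le _ hC0 hw
  · intro v
    rw [norm_div, norm_mul, norm_pow, Complex.norm_natCast, Complex.norm_natCast]
    have hb0 : (0 : ℝ) < q b.2 := by positivity
    have hj0 : (0 : ℝ) < q j := by positivity
    rw [div_le_div_iff₀ (by positivity) (by positivity)]
    refine (mul_le_mul_of_nonneg_right (hH v) (by positivity)).trans (le_of_eq ?_)
    push_cast [List.length_cons]
    ring
  · simp only [hscale]
    exact hint.const_mul _
  · simp only [hscale]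
    rw [integral_const_mul, hzero, mul_zero]

/-- Strong induction on the length. The closing block `j` and the matrix `B` must stay general,
because the prefix traces are closed on the block of `b` by either `1` or `D`. -/
theorem isNegligible_trace_eval [∀ n, IsProbabilityMeasure (μ n)]
    (hμ : ∀ n, IsTranslationInvariant (μ n))
    (hq : ∀ k, Tendsto (fun n => q n k) atTop atTop) {C : ℝ} (hC : 1 ≤ C) (w : WordSeq q)
    (hne : w ≠ []) (hw : w.IsBounded C) (hred : w.IsReduced) (j : Fin d)
    (B : ∀ n, BlockMatrix (q n)) (hB : ∀ n, ‖B n‖ ≤ C) :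
    IsNegligible μ fun n v => (v.eval (WordSeq.level w n) * (blockProj (q n) j * B n)).trace / q n j := by
  have hC0 : 0 ≤ C := zero_le_one.trans hC
  induction hlen : w.length using Nat.strong_induction_on generalizing w j B with
  | _ m ih =>
  subst hlen
  obtain _ | ⟨⟨b, ε, D⟩, w⟩ := w
  · exact absurd rfl hne
  have hfirst : ∀ (pre : WordSeq q) x post, w = pre ++ x :: post → x.1 = b →
      IsNegligible μ fun n v =>
        v.prefixTrace b x.2.1 (v.loopPrefix b ε (D n) * v.eval (pre.level n)) / q n b.2 := by
    intro pre x post h hx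
    have hlt : pre.length < w.length := by
      rw [h, List.length_append, List.length_cons]; omega
    have hpre : pre <:+: (b, ε, D) :: w :=
      ⟨[(b, ε, D)], x :: post, by rw [h]; rfl⟩
    have hpre' : (b, ε, D) :: pre <:+: (b, ε, D) :: w :=
      ⟨[], x :: post, by rw [h]; rfl⟩
    by_cases hε : ε = x.2.1
    -- Shorter than the whole word, since the occurrence `x` and what follows it are dropped.
    · have := ih ((b, ε, D) :: pre).length (by simp only [List.length_cons]; omega)
        ((b, ε, D) :: pre) (by simp)
        (fun y hy => hw y (hpre'.subset hy)) (hred.infix hpre') b.2 (fun _ => 1)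
        (fun n => norm_one_le.trans hC) rfl
      refine this.of_le fun n v => le_of_eq ?_
      rw [← hε, norm_div, norm_div, prefixTrace_loopPrefix_self]
      rfl
    · by_cases hpre0 : pre = []
      -- Immediate cancellation: no letter is left, and this is the only place where the centering
      -- in `IsReduced` is used.
      · subst hpre0
        have hc : Tendsto (fun n => condE (q n) (D n) b.2) atTop (𝓝 0) := by
          unfold WordSeq.IsReduced at hred
          rw [h, List.nil_append, List.isChain_cons_cons] at hred
          exact hred.1 hx.symm hε
        refine (isNegligible_const hc).of_le fun n v => le_of_eq ?_
        rw [norm_div, prefixTrace_loopPrefix_not v b ε x.2.1 hε, condE_apply, norm_mul, norm_inv,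
          div_eq_inv_mul]
        simp [WordSeq.level, eval]
      · have := ih pre.length (by simp only [List.length_cons]; omega) pre hpre0
          (fun y hy => hw y (hpre.subset hy)) (hred.infix hpre) b.2 D
          (fun n => hw (b, ε, D) (by simp) n) rfl
        refine this.of_le fun n v => le_of_eq ?_
        rw [norm_div, norm_div, prefixTrace_loopPrefix_not v b ε x.2.1 hε]
  have hsplit := isNegligible_splitSum (μ := μ) b j (fun n v => v.loopSuffix b ε (B n)) hC0
    (fun n v => (v.norm_loopSuffix_le _ _ _).trans (hB n)) w
    (fun x hx => hw x (List.mem_cons_of_mem _ hx)) (fun n v => v.loopPrefix b ε (D n))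
    (fun n => stronglyMeasurable_loopPrefix _ _ _) hfirst
  have hqR : ∀ k, Tendsto (fun n => (q n k : ℝ)) atTop atTop := fun k =>
    tendsto_natCast_atTop_atTop.comp (hq k)
  have hlim : Tendsto (fun n => ENNReal.ofReal (C * C ^ (w.length + 1)) *
      ∫⁻ v, ‖v.splitSum b (blockProj (q n) j * v.loopSuffix b ε (B n)) (v.loopPrefix b ε (D n))
        (WordSeq.level w n) / (q n b.2 * q n j)‖ₑ ∂μ n +
      ENNReal.ofReal ((w.length + 1) * (C * C ^ (w.length + 1)) ^ 2 / (q n b.2 * q n j)))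
      atTop (𝓝 0) := by
    have h1 := ENNReal.Tendsto.const_mul (a := ENNReal.ofReal (C * C ^ (w.length + 1))) hsplit
      (Or.inr ENNReal.ofReal_ne_top)
    have h2 : Tendsto (fun n => (w.length + 1) * (C * C ^ (w.length + 1)) ^ 2 /
        ((q n b.2 : ℝ) * q n j)) atTop (𝓝 0) :=
      tendsto_const_nhds.div_atTop ((hqR b.2).atTop_mul_atTop₀ (hqR j))
    simpa using h1.add (ENNReal.tendsto_ofReal h2)
  have hsq : Tendsto (fun n => ∫⁻ v, ‖(v.eval (WordSeq.level ((b, ε, D) :: w) n) *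
      (blockProj (q n) j * B n)).trace / q n j‖ₑ ^ 2 ∂μ n) atTop (𝓝 0) := by
    refine tendsto_of_tendsto_of_tendsto_of_le_of_le' tendsto_const_nhds hlim
      (Eventually.of_forall fun n => zero_le) ?_
    -- The normalized estimate divides by both block sizes, which may vanish for small `n`.
    filter_upwards [(hq b.2).eventually_ne_atTop 0, (hq j).eventually_ne_atTop 0] with n hb hj
    have := lintegral_enorm_sq_trace_le (hμ n) b ε (D n) (WordSeq.level w n) j (B n) hC
      (WordSeq.IsBounded.norm_level_le hw n) (hB n) hb hj
    simpa only [WordSeq.level, List.length_map, List.map_cons] using this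
  have hroot := (ENNReal.continuous_rpow_const (y := (1 / 2 : ℝ))).tendsto 0 |>.comp hsq
  rw [ENNReal.zero_rpow_of_pos (by norm_num)] at hroot
  refine tendsto_of_tendsto_of_tendsto_of_le_of_le tendsto_const_nhds hroot
    (fun n => zero_le) fun n => ?_
  refine lintegral_enorm_le_rpow_lintegral_enorm_sq ?_
  simp only [div_eq_mul_inv]
  exact ((stronglyMeasurable_eval _).mul_const _).matrix_trace.mul_const _

end UnitaryFamily
end WordSequences

/-! ### From alternating products to reduced words, and convergence in probability -/

section MainTheorem

variable {d : ℕ}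

namespace BlockUnitary

variable {q : Fin d → ℕ} {k : Fin d}

/-- Restricted to positive exponents: the zeroth power is `p_k` in the group but the identity among
matrices. -/
theorem toMatrix_pow_succ (V : BlockUnitary q k) (n : ℕ) :
    (V ^ (n + 1)).toMatrix = V.toMatrix ^ (n + 1) := by
  induction n with
  | zero => simp
  | succ n ih => rw [pow_succ, toMatrix_mul, ih, ← pow_succ]

end BlockUnitary

namespace UnitaryFamily

variable {q : Fin d → ℕ}

theorem letter_pow_natAbs (v : UnitaryFamily q) (a : ℕ × Fin d) {m : ℤ} (hm : m ≠ 0) :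
    v.letter a (decide (0 < m)) ^ (m.natAbs - 1 + 1) = (v a ^ m).toMatrix := by
  have hn : m.natAbs - 1 + 1 = m.natAbs := Nat.sub_add_cancel (Int.natAbs_pos.2 hm)
  rcases lt_or_gt_of_ne hm with h | h
  · have h0 : ¬ 0 < m := by omega
    have hV : v a ^ m = (v a)⁻¹ ^ (m.natAbs - 1 + 1) := by
      rw [hn, ← zpow_natCast, inv_zpow', Int.ofNat_natAbs_of_nonpos h.le, neg_neg]
    rw [hV, BlockUnitary.toMatrix_pow_succ, BlockUnitary.toMatrix_inv]
    simp [letter, h0]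
  · have hV : v a ^ m = v a ^ (m.natAbs - 1 + 1) := by
      rw [hn, ← zpow_natCast, Int.natAbs_of_nonneg h.le]
    rw [hV, BlockUnitary.toMatrix_pow_succ]
    simp [letter, h]

theorem eval_replicate (v : UnitaryFamily q) (a : ℕ × Fin d) (ε : Bool) (n : ℕ) :
    v.eval (List.replicate n (a, ε, 1)) = v.letter a ε ^ n := by
  induction n with
  | zero => rfl
  | succ n ih => rw [List.replicate_succ, eval, ih, pow_succ', Matrix.mul_one]

theorem eval_flatten (v : UnitaryFamily q) (L : List (UnitaryWord q)) :
    v.eval L.flatten = (L.map v.eval).prod := by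
  induction L with
  | nil => rfl
  | cons w L ih => rw [List.flatten_cons, eval_append, ih, List.map_cons, List.prod_cons]

/-- Multiplying one coordinate by `g` is a product map, and it leaves every factor of the product
measure unchanged. -/
theorem isTranslationInvariant_infinitePi (ν : (a : ℕ × Fin d) → Measure (BlockUnitary q a.2))
    [∀ a, IsProbabilityMeasure (ν a)] (hν : ∀ a, (ν a).IsMulLeftInvariant) :
    IsTranslationInvariant (Measure.infinitePi ν) := by
  intro b g
  let f : (a : ℕ × Fin d) → BlockUnitary q a.2 → BlockUnitary q a.2 :=
    Function.update (fun _ => id) b (g * ·)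
  have hf : ∀ a, Measurable (f a) := by
    intro a
    by_cases h : a = b
    · subst h
      simpa [f] using BlockUnitary.measurable_const_mul g
    · simpa [f, h] using measurable_id
  have heq : (fun v : UnitaryFamily q => Function.update v b (g * v b)) = fun v a => f a (v a) := by
    funext v a
    by_cases h : a = b
    · subst h; simp [f]
    · simp [f, h]
  rw [heq]
  refine ⟨by fun_prop, ?_⟩
  rw [Measure.infinitePi_map_pi _ hf]
  congr 1
  funext a
  by_cases h : a = b
  · subst h
    have := hν a
    simpa [f] using map_mul_left_eq_self (ν a) g
  · simp [f, h]

end UnitaryFamily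

namespace WordSeq

variable {q : ℕ → Fin d → ℕ}

/-- The word of `v a ^ m * D`. -/
def power (a : ℕ × Fin d) (m : ℤ) (D : (n : ℕ) → BlockMatrix (q n)) : WordSeq q :=
  List.replicate (m.natAbs - 1) (a, decide (0 < m), fun _ => 1) ++ [(a, decide (0 < m), D)]

theorem eval_power {n : ℕ} (v : UnitaryFamily (q n)) (a : ℕ × Fin d) {m : ℤ} (hm : m ≠ 0)
    (D : (n : ℕ) → BlockMatrix (q n)) :
    v.eval (level (power a m D) n) = (v a ^ m).toMatrix * D n := by
  rw [← v.letter_pow_natAbs a hm, pow_succ]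
  simp [level, power, UnitaryFamily.eval_append, UnitaryFamily.eval_replicate, UnitaryFamily.eval,
    Matrix.mul_assoc]

theorem mem_power {a : ℕ × Fin d} {m : ℤ} {D : (n : ℕ) → BlockMatrix (q n)}
    {x : (ℕ × Fin d) × Bool × ((n : ℕ) → BlockMatrix (q n))} (hx : x ∈ power a m D) :
    x.1 = a ∧ x.2.1 = decide (0 < m) ∧ (x.2.2 = (fun _ => 1) ∨ x.2.2 = D) := by
  rcases List.mem_append.1 hx with h | h
  · rw [List.eq_of_mem_replicate h]; simp
  · rw [List.mem_singleton.1 h]; simp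

/-- The word of an alternating product. -/
def alternating {N : ℕ} (a : Fin N → ℕ × Fin d) (m : Fin N → ℤ)
    (D : Fin N → (n : ℕ) → BlockMatrix (q n)) : WordSeq q :=
  (List.ofFn fun r => power (a r) (m r) (D r)).flatten

theorem eval_alternating {N n : ℕ} (v : UnitaryFamily (q n)) (s : Fin N → ℕ)
    (k : Fin N → Fin d) {m : Fin N → ℤ} (hm : ∀ r, m r ≠ 0)
    (D : Fin N → (n : ℕ) → BlockMatrix (q n)) :
    v.eval (level (alternating (fun r => (s r, k r)) m D) n) =
      alternatingProduct (q n) k (fun r => v (s r, k r)) m (fun r => D r n) := by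
  have h : level (alternating (fun r => (s r, k r)) m D) n =
      (List.ofFn fun r => level (power (s r, k r) (m r) (D r)) n).flatten := by
    rw [alternating, level, List.map_flatten, List.map_ofFn]
    rfl
  rw [h, UnitaryFamily.eval_flatten, List.map_ofFn, alternatingProduct]
  congr 2
  funext r
  exact eval_power v _ (hm r) _

theorem alternating_ne_nil {N : ℕ} [NeZero N] (a : Fin N → ℕ × Fin d) (m : Fin N → ℤ)
    (D : Fin N → (n : ℕ) → BlockMatrix (q n)) : alternating a m D ≠ [] := by
  refine List.ne_nil_of_mem (a := (a 0, decide (0 < m 0), D 0)) ?_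
  exact List.mem_flatten.2 ⟨power (a 0) (m 0) (D 0), List.mem_ofFn.2 ⟨0, rfl⟩, by simp [power]⟩

theorem isBounded_alternating {N : ℕ} (a : Fin N → ℕ × Fin d) (m : Fin N → ℤ)
    {D : Fin N → (n : ℕ) → BlockMatrix (q n)} {C : ℝ} (hC : 1 ≤ C)
    (hD : ∀ r n, ‖D r n‖ ≤ C) : (alternating a m D).IsBounded C := by
  intro x hx n
  obtain ⟨l, hl, hxl⟩ := List.mem_flatten.1 hx
  obtain ⟨r, rfl⟩ := List.mem_ofFn.1 hl
  rcases (mem_power hxl).2.2 with h | h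
  · rw [h]; exact UnitaryFamily.norm_one_le.trans hC
  · rw [h]; exact hD r n

theorem isReduced_alternating {N : ℕ} (a : Fin N → ℕ × Fin d) (m : Fin N → ℤ)
    {D : Fin N → (n : ℕ) → BlockMatrix (q n)}
    (h : ∀ (i : ℕ) (hi : i + 1 < N), a ⟨i, Nat.lt_of_succ_lt hi⟩ = a ⟨i + 1, hi⟩ →
      Tendsto (fun n => condE (q n) (D ⟨i, Nat.lt_of_succ_lt hi⟩ n)) atTop (𝓝 0)) :
    (alternating a m D).IsReduced := by
  refine (List.isChain_flatten ?_).2 ⟨?_, List.isChain_ofFn.2 ?_⟩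
  · rw [List.mem_ofFn]
    rintro ⟨r, hr⟩
    simp [power] at hr
  · intro l hl
    obtain ⟨r, rfl⟩ := List.mem_ofFn.1 hl
    -- Inside one power all exponents have the same sign, so the condition is vacuous there; only
    -- junctions of powers matter.
    refine List.Pairwise.isChain (List.pairwise_of_forall_mem_list fun x hx y hy _ hne => ?_)
    exact absurd ((mem_power hx).2.1.trans (mem_power hy).2.1.symm) hne
  · intro i hi x hx y hy hxy _
    have hx' : x = (a ⟨i, Nat.lt_of_succ_lt hi⟩, decide (0 < m ⟨i, Nat.lt_of_succ_lt hi⟩),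
        D ⟨i, Nat.lt_of_succ_lt hi⟩) := by
      simpa [power, eq_comm] using hx
    have hy' := (mem_power (List.mem_of_mem_head? hy)).1
    subst hx'
    exact (tendsto_pi_nhds.1 (h i hi (hxy.trans hy')) _)

end WordSeq

/-- Markov's inequality in each coordinate and a union bound over the `d` coordinates of the sup
norm. -/
theorem tendsto_measure_norm_le_of_lintegral {Ω : ℕ → Type*} [∀ n, MeasurableSpace (Ω n)]
    {P : (n : ℕ) → Measure (Ω n)} [∀ n, IsProbabilityMeasure (P n)]
    (X : (n : ℕ) → Ω n → Fin d → ℂ) (hX : ∀ n k, Measurable fun ω => X n ω k)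
    (hlim : ∀ k, Tendsto (fun n => ∫⁻ ω, ‖X n ω k‖ₑ ∂P n) atTop (𝓝 0)) {η : ℝ} (hη : 0 < η) :
    Tendsto (fun n => P n {ω | ‖X n ω‖ ≤ η}) atTop (𝓝 1) := by
  have hη' : ENNReal.ofReal η ≠ 0 := by simpa using hη
  have hsum : Tendsto (fun n => 1 - ∑ k, (∫⁻ ω, ‖X n ω k‖ₑ ∂P n) / ENNReal.ofReal η) atTop
      (𝓝 1) := by
    have h : Tendsto (fun n => ∑ k, (∫⁻ ω, ‖X n ω k‖ₑ ∂P n) / ENNReal.ofReal η) atTop (𝓝 0) := by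
      have := tendsto_finsetSum (Finset.univ : Finset (Fin d)) fun k _ =>
        ENNReal.Tendsto.div_const (hlim k) (Or.inr hη')
      simpa using this
    simpa using ENNReal.Tendsto.sub tendsto_const_nhds h (Or.inl ENNReal.one_ne_top)
  refine tendsto_of_tendsto_of_tendsto_of_le_of_le hsum tendsto_const_nhds (fun n => ?_)
    fun n => prob_le_one
  refine tsub_le_iff_right.2 ?_
  have hcover : (Set.univ : Set (Ω n)) ⊆ {ω | ‖X n ω‖ ≤ η} ∪
      ⋃ k, {ω | ENNReal.ofReal η ≤ ‖X n ω k‖ₑ} := by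
    intro ω _
    by_contra hω
    simp only [Set.mem_union, Set.mem_ofPred_eq, Set.mem_iUnion, not_or, not_exists, not_le] at hω
    refine absurd ((pi_norm_le_iff_of_nonneg hη.le).2 fun k => ?_) hω.1.not_ge
    have := hω.2 k
    rw [← ofReal_norm, ENNReal.ofReal_lt_ofReal_iff hη] at this
    exact this.le
  calc (1 : ℝ≥0∞) = P n Set.univ := measure_univ.symm
    _ ≤ P n {ω | ‖X n ω‖ ≤ η} + P n (⋃ k, {ω | ENNReal.ofReal η ≤ ‖X n ω k‖ₑ}) :=
        (measure_mono hcover).trans (measure_union_le _ _)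
    _ ≤ _ := by
        gcongr
        refine (measure_iUnion_fintype_le _ _).trans (Finset.sum_le_sum fun k _ => ?_)
        exact meas_ge_le_lintegral_div (hX n k).enorm.aemeasurable hη' ENNReal.ofReal_ne_top

/-- Common form of the two cases. The left factor `D₀` is moved by cyclicity into the closing
matrix, where only boundedness matters. The bound `max R 1` also covers the identities inserted in
the powers. -/
theorem tendsto_measure_norm_condE_alternatingProduct_le (q : ℕ → Fin d → ℕ)
    (hq_top : ∀ k, Tendsto (fun n => q n k) atTop atTop)
    (Ω : ℕ → Type*) [∀ n, MeasurableSpace (Ω n)]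
    (P : (n : ℕ) → Measure (Ω n)) [∀ n, IsProbabilityMeasure (P n)]
    (V : (n : ℕ) → ℕ → (k : Fin d) → Ω n → BlockUnitary (q n) k)
    (hV_unif : ∀ n s k, IsUniformBlockUnitary (q n) k (P n) (V n s k))
    (hV_indep : ∀ n, iIndepFun (fun (sk : ℕ × Fin d) => V n sk.1 sk.2) (P n))
    (N : ℕ) [NeZero N] {R : ℝ} (D₀ : (n : ℕ) → BlockMatrix (q n))
    (D : Fin N → (n : ℕ) → BlockMatrix (q n))
    (s : Fin N → ℕ) (k : Fin N → Fin d) (m : Fin N → ℤ) {η : ℝ}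
    (hD₀ : ∀ n, ‖D₀ n‖ ≤ max R 1) (hD : ∀ r n, ‖D r n‖ ≤ R)
    (htype : ∀ r : Fin N, (r : ℕ) + 1 < N →
      IsProjectorSeq q (D r) ∨ IsCenteredAlmostDiagonalSeq q (D r))
    (hne : ∀ r : Fin N, (r : ℕ) + 1 < N → IsProjectorSeq q (D r) →
      (s r, k r) ≠ (s (r + 1), k (r + 1)))
    (hm : ∀ r, m r ≠ 0) (hη : 0 < η) :
    Tendsto
      (fun n => P n {ω |
        ‖condE (q n) (D₀ n * alternatingProduct (q n) k (fun r => V n (s r) (k r) ω) m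
          (fun r => D r n))‖ ≤ η})
      atTop (𝓝 1) := by
  let F : (n : ℕ) → Ω n → UnitaryFamily (q n) := fun n ω a => V n a.1 a.2 ω
  have hF : ∀ n, Measurable (F n) := fun n => measurable_pi_iff.2 fun a => (hV_unif n a.1 a.2).1
  have hinv : ∀ n, UnitaryFamily.IsTranslationInvariant ((P n).map (F n)) := by
    intro n
    have h := (hV_indep n).map_fun_eq_infinitePi_map fun a => (hV_unif n a.1 a.2).1
    have : ∀ a : ℕ × Fin d, IsProbabilityMeasure ((P n).map (V n a.1 a.2)) := fun a =>
      Measure.isProbabilityMeasure_map (hV_unif n a.1 a.2).1.aemeasurable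
    change UnitaryFamily.IsTranslationInvariant ((P n).map fun ω a => V n a.1 a.2 ω)
    rw [h]
    exact UnitaryFamily.isTranslationInvariant_infinitePi _ fun a =>
      (hV_unif n a.1 a.2).2.toIsMulLeftInvariant
  have hprob : ∀ n, IsProbabilityMeasure ((P n).map (F n)) := fun n =>
    Measure.isProbabilityMeasure_map (hF n).aemeasurable
  let w : WordSeq q := WordSeq.alternating (fun r => (s r, k r)) m D
  have hred : w.IsReduced := by
    refine WordSeq.isReduced_alternating _ _ fun i hi heq => ?_
    -- Away from the last index the cyclic successor of `Fin N` is the ordinary one.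
    have hsucc : (⟨i, Nat.lt_of_succ_lt hi⟩ : Fin N) + 1 = ⟨i + 1, hi⟩ :=
      Fin.ext (Fin.val_add_one_of_lt' hi)
    rcases htype ⟨i, Nat.lt_of_succ_lt hi⟩ hi with h | h
    · exact absurd heq (hsucc ▸ hne ⟨i, Nat.lt_of_succ_lt hi⟩ hi h)
    · exact h.2
  have hneg := fun κ => UnitaryFamily.isNegligible_trace_eval hinv hq_top (le_max_right R 1) w
    (WordSeq.alternating_ne_nil _ _ _)
    (WordSeq.isBounded_alternating _ _ (le_max_right R 1) fun r n =>
      (hD r n).trans (le_max_left R 1)) hred κ D₀ hD₀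
  have hval : ∀ n ω κ, condE (q n) (D₀ n * alternatingProduct (q n) k
      (fun r => V n (s r) (k r) ω) m (fun r => D r n)) κ =
      ((F n ω).eval (WordSeq.level w n) * (blockProj (q n) κ * D₀ n)).trace / q n κ := by
    intro n ω κ
    rw [condE_apply, WordSeq.eval_alternating _ _ _ hm, div_eq_inv_mul, ← Matrix.mul_assoc,
      Matrix.trace_mul_comm]
  have hmeas : ∀ n κ, StronglyMeasurable fun v : UnitaryFamily (q n) =>
      (v.eval (WordSeq.level w n) * (blockProj (q n) κ * D₀ n)).trace / (q n κ : ℂ) := by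
    intro n κ
    simp only [div_eq_mul_inv]
    exact ((UnitaryFamily.stronglyMeasurable_eval _).mul_const _).matrix_trace.mul_const _
  refine tendsto_measure_norm_le_of_lintegral (fun n ω => condE (q n) (D₀ n * alternatingProduct
    (q n) k (fun r => V n (s r) (k r) ω) m (fun r => D r n))) (fun n κ => ?_) (fun κ => ?_) hη
  · simp only [hval]
    exact (hmeas n κ).measurable.comp (hF n)
  · simp only [hval]
    refine (hneg κ).congr fun n => ?_
    exact lintegral_map (hmeas n κ).enorm (hF n)

end MainTheorem

end UnitaryWords

theorem mainTheorem12
    -- the block sizes `q n k`, with `q n 0 + ⋯ + q n (d - 1) = n`; index `0` is the first block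
    (d : ℕ) [NeZero d] (q : ℕ → Fin d → ℕ) (ρ : Fin d → ℝ)
    (hq_sum : ∀ n, ∑ k, q n k = n)
    (hq_top : ∀ k, Tendsto (fun n => q n k) atTop atTop)
    (hq_ratio : ∀ k, Tendsto (fun n => (q n k : ℝ) / (n : ℝ)) atTop (𝓝 (ρ k)))
    (hρ : ∀ k l, ρ k = 0 → ρ l = 0 → k = l)
    -- for each `n`, an independent family of uniform random elements of the groups `𝕌_k(n)`
    (Ω : ℕ → Type*) [∀ n, MeasurableSpace (Ω n)]
    (P : (n : ℕ) → Measure (Ω n)) [∀ n, IsProbabilityMeasure (P n)]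
    (V : (n : ℕ) → ℕ → (k : Fin d) → Ω n → BlockUnitary (q n) k)
    (hV_unif : ∀ n s k, IsUniformBlockUnitary (q n) k (P n) (V n s k))
    (hV_indep : ∀ n, iIndepFun (fun (sk : ℕ × Fin d) => V n sk.1 sk.2) (P n))
    (N : ℕ) [NeZero N] (R : ℝ) (hR : 0 < R) :
    -- first case; `r + 1` is the cyclic successor in `Fin N`
    (∀ (D : Fin N → (n : ℕ) → BlockMatrix (q n))
        (s : Fin N → ℕ) (k : Fin N → Fin d) (m : Fin N → ℤ) (η : ℝ),
        (∀ r n, matrixOpNorm (D r n) ≤ R) →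
        (∀ r, IsProjectorSeq q (D r) ∨ IsCenteredAlmostDiagonalSeq q (D r)) →
        (∀ r, IsProjectorSeq q (D r) → (s r, k r) ≠ (s (r + 1), k (r + 1))) →
        (∀ r, m r ≠ 0) →
        0 < η →
        Tendsto
          (fun n => P n {ω |
            ‖condE (q n) (alternatingProduct (q n) k (fun r => V n (s r) (k r) ω) m
              (fun r => D r n))‖ ≤ η})
          atTop (𝓝 1)) ∧
    -- second case; the last factor is the `D r` with `r + 1 = N`
    (∀ (D₀ : (n : ℕ) → BlockMatrix (q n)) (D : Fin N → (n : ℕ) → BlockMatrix (q n))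
        (s : Fin N → ℕ) (k : Fin N → Fin d) (m : Fin N → ℤ) (η : ℝ),
        (∀ n, matrixOpNorm (D₀ n) ≤ R) →
        (∀ r n, matrixOpNorm (D r n) ≤ R) →
        (∃ v : Fin d, ∀ n, IsAlmostDiagonal (q n) 0 v (D₀ n)) →
        (∀ r : Fin N, (r : ℕ) + 1 = N →
          ∃ u : Fin d, ∀ n, IsAlmostDiagonal (q n) u 0 (D r n)) →
        (∀ r : Fin N, (r : ℕ) + 1 < N →
          IsProjectorSeq q (D r) ∨ IsCenteredAlmostDiagonalSeq q (D r)) →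
        (∀ r : Fin N, (r : ℕ) + 1 < N → IsProjectorSeq q (D r) →
          (s r, k r) ≠ (s (r + 1), k (r + 1))) →
        (∀ r, m r ≠ 0) →
        0 < η →
        Tendsto
          (fun n => P n {ω |
            ‖condE (q n) (D₀ n * alternatingProduct (q n) k (fun r => V n (s r) (k r) ω) m
              (fun r => D r n))‖ ≤ η})
          atTop (𝓝 1)) := by
  refine ⟨fun D s k m η hD htype hne hm hη => ?_,
    fun D₀ D s k m η hD₀ hD _ _ htype hne hm hη => ?_⟩
  -- The first case is `D₀ = 1`. The bounds on `matrixOpNorm` serve directly as bounds for the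
  -- scoped norm, the two being definitionally equal.
  · have h := tendsto_measure_norm_condE_alternatingProduct_le q hq_top Ω P V hV_unif hV_indep N
      (fun _ => 1) D s k m (fun n => UnitaryFamily.norm_one_le.trans (le_max_right R 1)) hD
      (fun r _ => htype r) (fun r _ => hne r) hm hη
    simpa only [Matrix.one_mul] using h
  · exact tendsto_measure_norm_condE_alternatingProduct_le q hq_top Ω P V hV_unif hV_indep N
      D₀ D s k m (fun n => (hD₀ n).trans (le_max_left R 1)) hD htype hne hm hη
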